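/- Notation. For $f:\{0,1\}^n\to\mathbb R$ let $\|f\|_q=\big(2^{-n}\sum_{x}|f(x)|^q\big)^{1/q}$ for real $q\ge 1$, and $\|f\|_\infty=\max_x|f(x)|$. For $0\le\epsilon\le\frac12$ let $(T_\epsilon f)(x)=\sum_{y\in\{0,1\}^n}\epsilon^{|y-x|}(1-\epsilon)^{n-|y-x|}f(y)$, where $|y-x|$ is the Hamming distance. Let $\lambda(q,\epsilon)=1+\frac1{q-1}\log_2\big(\epsilon^q+(1-\epsilon)^q\big)$ for $1<q<\infty$ and $\lambda(\infty,\epsilon)=1+\log_2(1-\epsilon)$. For a binary linear code $C\subseteq\{0,1\}^n$ and $T\subseteq\{1,\dots,n\}$ let $r_C(T)$ be the rank over $\mathbb F_2$ of the submatrix formed by the columns indexed by $T$ of a generating matrix of $C$. Let $T\sim p$ denote a random subset of $\{1,\dots,n\}$ containing each element independently with probability $p$. A pseudorandom code of rate $R$ is a family of binary linear codes $C_k\subseteq\{0,1\}^{n_k}$, $k\in\mathbb N$, with $n_k\to\infty$ and $\frac{\dim C_k}{n_k}\to R$, which achieves capacity for the binary erasure channel under bit-MAP decoding, that is, $\mathbb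 E_{T\sim R}\big(|T|-r_{C_k}(T)\big)=o(n_k)$ as $k\to\infty$. Proposition. (i) Let $0<R<1$, let $(C_k)$ be a pseudorandom code of rate $R$, and let $f_k=\frac{2^{n_k}}{|C_k|}\cdot 1_{C_k}$. Then for every $\eta>0$ there is $k_0$ such that for all $k\ge k_0$, all integers $q\ge2$ and all $0\le\epsilon\le\frac12$ with $\lambda(q,\epsilon)\ge R$, $$\frac1{n_k}\log_2\|T_\epsilon f_k\|_q\le\frac{q-1}q\big(\lambda(q,\epsilon)-R\big)+\eta,$$ and for all $k\ge k_0$ and all $0\le\epsilon\le\frac12$ with $\lambda(\infty,\epsilon)\ge R$, $$\frac1{n_k}\log_2\|T_\epsilon f_k\|_\infty\le\lambda(\infty,\epsilon)-R+\eta.$$ (ii) Let $n\ge1$, let $f$ be a nonnegative function on $\{0,1\}^n$, not identically zero, and let $R\in\mathbb R$. If $q\ge1$ is real and $\frac1n\log_2\|f\|_q=\frac{q-1}q(1-R)$, then for all $0\le\epsilon\le\frac12$ $$\frac1n\log_2\|T_\epsilon f\|_q\ge\frac{q-1}q\big(\lambda(q,\epsilon)-R\big)$$ (for $q=1$ the right-hand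 side is read as $0$). If $\frac1n\log_2\|f\|_\infty=1-R$, then for all $0\le\epsilon\le\frac12$ $$\frac1n\log_2\|T_\epsilon f\|_\infty\ge\lambda(\infty,\epsilon)-R.$$ -/

import Mathlib

open Filter Topology Asymptotics

noncomputable section

/-- The boolean cube of dimension `n`, viewed as a vector space over the field with two elements. -/
abbrev Cube (n : ℕ) : Type := Fin n → ZMod 2

/-- A binary linear code of length `n`. -/
abbrev BinaryLinearCode (n : ℕ) : Type := Submodule (ZMod 2) (Cube n)

/-- `G` is a generating matrix of `C`: its rows are linearly independent and span `C`. -/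
def IsGeneratingMatrix {n k : ℕ} (C : BinaryLinearCode n) (G : Matrix (Fin k) (Fin n) (ZMod 2)) :
    Prop :=
  LinearIndependent (ZMod 2) G.row ∧ Submodule.span (ZMod 2) (Set.range G.row) = C

/-- A generating matrix of `C`: its rows are a basis of `C`. -/
def generatingMatrix {n : ℕ} (C : BinaryLinearCode n) :
    Matrix (Fin (Module.finrank (ZMod 2) C)) (Fin n) (ZMod 2) :=
  Matrix.of fun i j => (Module.finBasis (ZMod 2) C i : Cube n) j

/-- The rank of the submatrix of `G` which contains the columns indexed by `T`. -/
def columnRank {n k : ℕ} (G : Matrix (Fin k) (Fin n) (ZMod 2)) (T : Finset (Fin n)) : ℕ :=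
  (G.submatrix id (fun j : T => (j : Fin n))).rank

/-- The rank function `r_C` of the binary matroid of the code `C`. -/
def codeRank {n : ℕ} (C : BinaryLinearCode n) (T : Finset (Fin n)) : ℕ :=
  columnRank (generatingMatrix C) T

theorem generatingMatrix_isGeneratingMatrix {n : ℕ} (C : BinaryLinearCode n) :
    IsGeneratingMatrix C (generatingMatrix C) := by
  have hrow : (generatingMatrix C).row = C.subtype ∘ Module.finBasis (ZMod 2) C := by
    funext i j
    rfl
  refine ⟨?_, ?_⟩
  · rw [hrow]
    exact (Module.finBasis (ZMod 2) C).linearIndependent.map' C.subtype (Submodule.ker_subtype C)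
  · rw [hrow, Set.range_comp, Submodule.span_image, (Module.finBasis (ZMod 2) C).span_eq,
      Submodule.map_subtype_top]

theorem columnRank_eq_finrank_map {n k : ℕ} {C : BinaryLinearCode n}
    {G : Matrix (Fin k) (Fin n) (ZMod 2)} (hG : IsGeneratingMatrix C G) (T : Finset (Fin n)) :
    columnRank G T = Module.finrank (ZMod 2)
      (C.map (LinearMap.funLeft (ZMod 2) (ZMod 2) (fun j : T => (j : Fin n)))) := by
  have hrow : (G.submatrix id (fun j : T => (j : Fin n))).row =
      LinearMap.funLeft (ZMod 2) (ZMod 2) (fun j : T => (j : Fin n)) ∘ G.row := by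
    funext i j
    rfl
  rw [columnRank, Matrix.rank_eq_finrank_span_row, hrow, Set.range_comp, Submodule.span_image, hG.2]

/-- The rank function does not depend on the choice of the generating matrix. -/
theorem codeRank_eq_columnRank {n k : ℕ} {C : BinaryLinearCode n}
    {G : Matrix (Fin k) (Fin n) (ZMod 2)} (hG : IsGeneratingMatrix C G) (T : Finset (Fin n)) :
    codeRank C T = columnRank G T := by
  rw [codeRank, columnRank_eq_finrank_map hG,
    columnRank_eq_finrank_map (generatingMatrix_isGeneratingMatrix C)]

/-- The rate `dim C / n` of a binary linear code. -/
def codeRate {n : ℕ} (C : BinaryLinearCode n) : ℝ :=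
  (Module.finrank (ZMod 2) C : ℝ) / n

/-- The expectation of `g T` where `T` is a random subset of `{1, …, n}` in which each element is
chosen independently with probability `p`. -/
def expectRandomSubset {n : ℕ} (p : ℝ) (g : Finset (Fin n) → ℝ) : ℝ :=
  ∑ T : Finset (Fin n), p ^ T.card * (1 - p) ^ (n - T.card) * g T

/-- The family of codes `C k`, of lengths `n k → ∞`, is a pseudorandom code of rate `R`: the rates
of the codes tend to `R`, and the family achieves the capacity of the binary erasure channel under
bit-MAP decoding, that is `𝔼_{T ∼ R} (|T| - r_C(T)) = o(n)`. -/
structure IsPseudorandomCode (R : ℝ) (n : ℕ → ℕ) (C : ∀ k, BinaryLinearCode (n k)) : Prop where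
  length_tendsto : Tendsto n atTop atTop
  rate_tendsto : Tendsto (fun k => codeRate (C k)) atTop (𝓝 R)
  achieves_capacity :
    (fun k => expectRandomSubset R
        (fun T : Finset (Fin (n k)) => (T.card : ℝ) - (codeRank (C k) T : ℝ)))
      =o[atTop] (fun k => (n k : ℝ))

/-- The noise operator `T_ε`. -/
def noiseOp {n : ℕ} (ε : ℝ) (f : Cube n → ℝ) (x : Cube n) : ℝ :=
  ∑ y : Cube n, ε ^ hammingDist y x * (1 - ε) ^ (n - hammingDist y x) * f y

/-- The `ℓ_q` norm of a function on the cube with respect to the uniform probability measure,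
`(𝔼 |f| ^ q) ^ (1 / q)`, for a finite real exponent `q`. -/
def cubeNorm {n : ℕ} (q : ℝ) (f : Cube n → ℝ) : ℝ :=
  ((∑ x : Cube n, |f x| ^ q) / 2 ^ n) ^ (1 / q)

/-- The `ℓ_∞` norm of a function on the cube. -/
def cubeSupNorm {n : ℕ} (f : Cube n → ℝ) : ℝ :=
  ⨆ x : Cube n, |f x|

/-- `λ(q, ε) = 1 + (1 / (q - 1)) log₂ (ε ^ q + (1 - ε) ^ q)` for finite `q`. -/
def noiseLambda (q ε : ℝ) : ℝ :=
  1 + 1 / (q - 1) * Real.logb 2 (ε ^ q + (1 - ε) ^ q)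

/-- `λ(∞, ε) = 1 + log₂ (1 - ε)`. -/
def noiseLambdaTop (ε : ℝ) : ℝ :=
  1 + Real.logb 2 (1 - ε)

/-- The normalized characteristic function `(2 ^ n / |C|) · 1_C` of a code. -/
def codeFun {n : ℕ} (C : BinaryLinearCode n) : Cube n → ℝ :=
  (C : Set (Cube n)).indicator (fun _ => 2 ^ n / (Nat.card C : ℝ))

end

/-! Part (i) rests on an inequality for a single bit. Write λ = λ(q, ε), and let E average out that
bit. For nonnegative f, ‖T_ε f‖_q ≤ ‖E f‖_q^(1-λ) ‖f‖_q^λ (`two_point_inequality`,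
`sum_pow_noise_coord_le`). Applied to one coordinate after another, its logarithm becomes log ‖T_ε
f‖_q ≤ 𝔼_{T∼λ} log ‖E(f|T)‖_q: each coordinate is kept with probability λ and averaged out otherwise
(`le_subsetExp_condVec`). For the normalized indicator of a code, E(f|T) has mean 1 and is at most
2^(|T| - r_C(T)), so log₂ of its norm is at most (q-1)/q · (|T| - r_C(T)). Because the rank is
monotone, the expectation of |T| - r_C(T) at probability λ exceeds the one at R, which is o(n), by
at most (λ - R)n.

The two-point inequality amounts to L(ad) L(1) ≤ L(a) L(d), where L(x) is the logarithm of the q-th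
moment of the values 1 ± x, d = 1 - 2ε and λ = L(d)/L(1) (`log_symPow_mul_le`). It follows from the
monotonicity in x of a L'(ax)/L'(x), which is derived from that of t(ax)/t(x) for t(x) = tanh((q-1)
artanh x). The case q = ∞ uses only the concavity of a power.

Part (ii) follows from the superadditivity of s ↦ s^q on nonnegative reals, and at q = ∞ from
dropping all but one term. -/

/-! ### Monotonicity of hyperbolic quotients -/

theorem add_inv_le_add_inv {a b : ℝ} (ha : 1 ≤ a) (hab : a ≤ b) : a + a⁻¹ ≤ b + b⁻¹ := by
  have ha0 : 0 < a := by linarith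
  have hb0 : 0 < b := by linarith
  have h : b + b⁻¹ - (a + a⁻¹) = (b - a) * (a * b - 1) / (a * b) := by
    field_simp
    ring
  have : 0 ≤ (b - a) * (a * b - 1) / (a * b) := by
    apply div_nonneg _ (by positivity)
    apply mul_nonneg (by linarith)
    nlinarith
  linarith

/-- The quotient `(z ^ m - z⁻¹ ^ m) / (z - z⁻¹)` is nondecreasing for `z ≥ 1`. -/
theorem exists_monotone_quotient (m : ℕ) : ∃ V : ℝ → ℝ, MonotoneOn V (Set.Ici 1) ∧
    (∀ z, 1 ≤ z → 0 ≤ V z) ∧ ∀ z, 1 ≤ z → z ^ m - z⁻¹ ^ m = (z - z⁻¹) * V z := by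
  induction m with
  | zero => exact ⟨fun _ => 0, monotoneOn_const, fun _ _ => le_rfl, by simp⟩
  | succ m ih =>
    obtain ⟨V, hV, hV0, hVe⟩ := ih
    -- This is the addition formula for sinh, with z = e^w: sinh((m+1)w) = sinh(mw) cosh w +
    -- cosh(mw) sinh w, divided by sinh w.
    refine ⟨fun z => (V z * (z + z⁻¹) + (z ^ m + (z ^ m)⁻¹)) / 2, ?_, ?_, ?_⟩
    · intro a ha b hb hab
      have ha1 : (1 : ℝ) ≤ a := ha
      have hb1 : (1 : ℝ) ≤ b := hb
      have h1 := add_inv_le_add_inv ha1 hab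
      have h2 := add_inv_le_add_inv (one_le_pow₀ ha1 (n := m))
        (pow_le_pow_left₀ (by linarith) hab m)
      have h3 : V a * (a + a⁻¹) ≤ V b * (b + b⁻¹) :=
        mul_le_mul (hV ha hb hab) h1 (by positivity) (hV0 b hb1)
      show (_ : ℝ) / 2 ≤ _ / 2
      linarith
    · intro z hz
      have := hV0 z hz
      positivity
    · intro z hz
      have hz0 : z ≠ 0 := by positivity
      have h := hVe z hz
      have : (z - z⁻¹) * ((V z * (z + z⁻¹) + (z ^ m + (z ^ m)⁻¹)) / 2) =
          ((z + z⁻¹) * ((z - z⁻¹) * V z) + (z - z⁻¹) * (z ^ m + z⁻¹ ^ m)) / 2 := by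
        rw [inv_pow]
        ring
      rw [this, ← h]
      ring

/-- With g(x) = x f'(x)/f(x), the logarithmic derivative of the ratio, multiplied by x, is g(ax) -
g(x). This is nonnegative because ax ≤ x. -/
theorem monotoneOn_dilation_ratio {f f' : ℝ → ℝ}
    (hf : ∀ x ∈ Set.Ioo (0 : ℝ) 1, HasDerivAt f (f' x) x) (hpos : ∀ x ∈ Set.Ioo (0 : ℝ) 1, 0 < f x)
    (hanti : AntitoneOn (fun x => x * f' x / f x) (Set.Ioo 0 1)) {a : ℝ} (ha : 0 < a) (ha1 : a < 1) :
    MonotoneOn (fun x => f (a * x) / f x) (Set.Ioo 0 1) := by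
  have hmem : ∀ x ∈ Set.Ioo (0 : ℝ) 1, a * x ∈ Set.Ioo (0 : ℝ) 1 := fun x hx =>
    ⟨mul_pos ha hx.1, by nlinarith [hx.1, hx.2]⟩
  have hd : ∀ x ∈ Set.Ioo (0 : ℝ) 1, HasDerivAt (fun x => f (a * x) / f x)
      ((f' (a * x) * a * f x - f (a * x) * f' x) / f x ^ 2) x := by
    intro x hx
    have h1 : HasDerivAt (fun x => a * x) a x := by simpa using (hasDerivAt_id x).const_mul a
    exact ((hf _ (hmem x hx)).comp x h1).div (hf x hx) (hpos x hx).ne'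
  apply monotoneOn_of_deriv_nonneg (convex_Ioo 0 1)
  · exact fun x hx => (hd x hx).continuousAt.continuousWithinAt
  · rw [interior_Ioo]
    exact fun x hx => (hd x hx).differentiableAt.differentiableWithinAt
  · rw [interior_Ioo]
    intro x hx
    rw [(hd x hx).deriv]
    apply div_nonneg _ (by positivity)
    have h := hanti (hmem x hx) hx (by nlinarith [hx.1, hx.2])
    have p1 := hpos x hx
    have p2 := hpos _ (hmem x hx)
    simp only at h
    rw [div_le_div_iff₀ p1 p2] at h
    have hx0 := hx.1
    have h' : x * (f' x * f (a * x)) ≤ x * (f' (a * x) * a * f x) := by linarith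
    have := le_of_mul_le_mul_left h' hx0
    linarith

/-- `tanh (m * artanh x)` as a rational function of `x`. -/
noncomputable def tanhMul (m : ℕ) (x : ℝ) : ℝ :=
  ((1 + x) ^ m - (1 - x) ^ m) / ((1 + x) ^ m + (1 - x) ^ m)

theorem one_sub_pow_lt {m : ℕ} (hm : m ≠ 0) {x : ℝ} (hx : x ∈ Set.Ioo (0 : ℝ) 1) :
    (1 - x) ^ m < (1 + x) ^ m :=
  pow_lt_pow_left₀ (by linarith [hx.1]) (by linarith [hx.2]) hm

theorem tanhMul_pos {m : ℕ} (hm : m ≠ 0) {x : ℝ} (hx : x ∈ Set.Ioo (0 : ℝ) 1) :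
    0 < tanhMul m x := by
  have h := one_sub_pow_lt hm hx
  have h0 : 0 < (1 - x) ^ m := pow_pos (by linarith [hx.2]) m
  exact div_pos (by linarith) (by linarith)

theorem hasDerivAt_tanhMul (m : ℕ) {x : ℝ} (hx : x ∈ Set.Ioo (0 : ℝ) 1) :
    HasDerivAt (tanhMul m) (4 * m * ((1 + x) ^ m * (1 - x) ^ m) /
      ((1 - x ^ 2) * ((1 + x) ^ m + (1 - x) ^ m) ^ 2)) x := by
  have e1 : 0 < 1 + x := by linarith [hx.1]
  have e2 : 0 < 1 - x := by linarith [hx.2]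
  have e3 : 1 - x ^ 2 = (1 + x) * (1 - x) := by ring
  have hA : HasDerivAt (fun x : ℝ => (1 + x) ^ m) (m * (1 + x) ^ (m - 1) * 1) x :=
    ((hasDerivAt_id x).const_add 1).pow m
  have hB : HasDerivAt (fun x : ℝ => (1 - x) ^ m) (m * (1 - x) ^ (m - 1) * (-1)) x :=
    ((hasDerivAt_id x).const_sub 1).pow m
  have hs : 0 < (1 + x) ^ m + (1 - x) ^ m := by positivity
  refine ((hA.sub hB).div (hA.add hB) hs.ne').congr_deriv ?_
  rw [e3]
  rcases m with _ | m
  · simp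
  · simp only [Nat.add_sub_cancel, Pi.add_apply, Pi.sub_apply]
    rw [div_eq_div_iff (by positivity) (by positivity)]
    push_cast
    ring

/-- Put x = tanh u. The function is then m sinh(2u)/sinh(2mu), that is, m/V(z) for the quotient V of
`exists_monotone_quotient` at z = e^(2u) = (1+x)/(1-x), which increases with x. -/
theorem antitoneOn_log_deriv_tanhMul {m : ℕ} (hm : m ≠ 0) :
    AntitoneOn (fun x => x * (4 * m * ((1 + x) ^ m * (1 - x) ^ m) /
      ((1 - x ^ 2) * ((1 + x) ^ m + (1 - x) ^ m) ^ 2)) / tanhMul m x) (Set.Ioo 0 1) := by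
  obtain ⟨V, hV, -, hVe⟩ := exists_monotone_quotient m
  have key : ∀ x ∈ Set.Ioo (0 : ℝ) 1, 1 ≤ (1 + x) / (1 - x) ∧ 0 < V ((1 + x) / (1 - x)) ∧
      x * (4 * m * ((1 + x) ^ m * (1 - x) ^ m) /
      ((1 - x ^ 2) * ((1 + x) ^ m + (1 - x) ^ m) ^ 2)) / tanhMul m x =
      m / V ((1 + x) / (1 - x)) := by
    intro x hx
    have e0 := hx.1
    have e1 : 0 < 1 + x := by linarith [hx.1]
    have e2 : 0 < 1 - x := by linarith [hx.2]
    have hz : 1 ≤ (1 + x) / (1 - x) := by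
      rw [le_div_iff₀ e2]; linarith
    have h := hVe _ hz
    have e3 : 1 - x ^ 2 = (1 + x) * (1 - x) := by ring
    have hAB := one_sub_pow_lt hm hx
    have hB0 : 0 < (1 - x) ^ m := pow_pos e2 m
    have hA0 : 0 < (1 + x) ^ m := pow_pos e1 m
    have hzz : (1 + x) / (1 - x) - ((1 + x) / (1 - x))⁻¹ = 4 * x / ((1 + x) * (1 - x)) := by
      field_simp
      ring
    rw [hzz, inv_div, div_pow, div_pow] at h
    set A := (1 + x) ^ m
    set B := (1 - x) ^ m
    have hVv : V ((1 + x) / (1 - x)) = ((1 + x) * (1 - x)) * ((A - B) * (A + B)) / (4 * x * (A * B)) := by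
      have : A / B - B / A = (A - B) * (A + B) / (A * B) := by
        field_simp
        ring
      rw [this] at h
      rw [eq_div_iff (by positivity)]
      field_simp at h
      linarith
    have hd : 0 < A - B := by linarith
    refine ⟨hz, ?_, ?_⟩
    · rw [hVv]; positivity
    · have : tanhMul m x = (A - B) / (A + B) := rfl
      rw [hVv, this, e3]
      field_simp
  intro x hx y hy hxy
  obtain ⟨x1, x2, x3⟩ := key x hx
  obtain ⟨y1, y2, y3⟩ := key y hy
  simp only
  rw [x3, y3]
  apply div_le_div_of_nonneg_left (by positivity) x2
  apply hV x1 y1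
  have := hx.2
  have := hy.2
  rw [div_le_div_iff₀ (by linarith) (by linarith)]
  nlinarith

theorem monotoneOn_tanhMul (m : ℕ) : MonotoneOn (tanhMul m) (Set.Ioo 0 1) := by
  apply monotoneOn_of_deriv_nonneg (convex_Ioo 0 1)
  · exact fun x hx => (hasDerivAt_tanhMul m hx).continuousAt.continuousWithinAt
  · rw [interior_Ioo]
    exact fun x hx => (hasDerivAt_tanhMul m hx).differentiableAt.differentiableWithinAt
  · rw [interior_Ioo]
    intro x hx
    rw [(hasDerivAt_tanhMul m hx).deriv]
    have e1 : 0 < 1 + x := by linarith [hx.1]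
    have e2 : 0 < 1 - x := by linarith [hx.2]
    have e3 : 1 - x ^ 2 = (1 + x) * (1 - x) := by ring
    rw [e3]
    positivity

/-! ### The moment inequality for two-point functions -/

/-- `symPow q x = ((1 + x) ^ q + (1 - x) ^ q) / 2` is the `q`-th moment of a two-point function
with mean one. -/
noncomputable def symPow (q : ℕ) (x : ℝ) : ℝ := ((1 + x) ^ q + (1 - x) ^ q) / 2

theorem symPow_pos (q : ℕ) {x : ℝ} (hx0 : 0 ≤ x) (hx1 : x ≤ 1) : 0 < symPow q x := by
  have h1 : 0 < (1 + x) ^ q := by positivity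
  have h2 : 0 ≤ (1 - x) ^ q := pow_nonneg (by linarith) q
  unfold symPow
  linarith

theorem hasDerivAt_log_symPow (m : ℕ) {x : ℝ} (hx0 : 0 ≤ x) (hx1 : x ≤ 1) :
    HasDerivAt (fun x => Real.log (symPow (m + 1) x))
      ((((m + 1 : ℕ) : ℝ) * ((1 + x) ^ m - (1 - x) ^ m) / 2) / symPow (m + 1) x) x := by
  have hA : HasDerivAt (fun x : ℝ => (1 + x) ^ (m + 1)) (((m + 1 : ℕ) : ℝ) * (1 + x) ^ m * 1) x :=
    ((hasDerivAt_id x).const_add 1).pow (m + 1)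
  have hB : HasDerivAt (fun x : ℝ => (1 - x) ^ (m + 1))
      (((m + 1 : ℕ) : ℝ) * (1 - x) ^ m * (-1)) x :=
    ((hasDerivAt_id x).const_sub 1).pow (m + 1)
  have h := ((hA.add hB).div_const 2).log (symPow_pos (m + 1) hx0 hx1).ne'
  refine h.congr_deriv ?_
  show _ / symPow (m + 1) x = _ / symPow (m + 1) x
  congr 1
  ring

/-- With A = (1+x)^m and B = (1-x)^m, the moment of order m+1 is (A + B + x(A - B))/2; dividing
through by A + B leaves only x and `tanhMul m x`. -/
theorem deriv_log_symPow_eq {m : ℕ} {x : ℝ} (hx : x ∈ Set.Ioo (0 : ℝ) 1) :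
    (((m + 1 : ℕ) : ℝ) * ((1 + x) ^ m - (1 - x) ^ m) / 2) / symPow (m + 1) x =
      ((m + 1 : ℕ) : ℝ) * tanhMul m x / (1 + x * tanhMul m x) := by
  have e0 := hx.1
  have e1 : 0 < 1 + x := by linarith [hx.1]
  have e2 : 0 < 1 - x := by linarith [hx.2]
  have hB0 : 0 < (1 - x) ^ m := pow_pos e2 m
  have hA0 : 0 < (1 + x) ^ m := pow_pos e1 m
  have hs : symPow (m + 1) x = ((1 + x) ^ m + (1 - x) ^ m +
      x * ((1 + x) ^ m - (1 - x) ^ m)) / 2 := by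
    unfold symPow
    ring
  have hp := symPow_pos (m + 1) hx.1.le hx.2.le
  rw [hs] at hp
  rw [hs, tanhMul]
  set A := (1 + x) ^ m
  set B := (1 - x) ^ m
  have h1 : 1 + x * ((A - B) / (A + B)) = (A + B + x * (A - B)) / (A + B) := by
    field_simp
  rw [h1]
  have h2 : 0 < A + B + x * (A - B) := by linarith
  field_simp

/-- The Rényi version of Mrs. Gerber's inequality for integer orders, in multiplicative form. -/
theorem log_symPow_mul_le {m : ℕ} (hm : m ≠ 0) {a d : ℝ} (ha0 : 0 ≤ a) (ha1 : a ≤ 1)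
    (hd0 : 0 ≤ d) (hd1 : d ≤ 1) :
    Real.log (symPow (m + 1) (a * d)) * Real.log (symPow (m + 1) 1) ≤
      Real.log (symPow (m + 1) a) * Real.log (symPow (m + 1) d) := by
  have hL0 : Real.log (symPow (m + 1) 0) = 0 := by simp [symPow]
  rcases ha0.eq_or_lt with rfl | ha
  · simp [hL0]
  rcases ha1.eq_or_lt with rfl | ha'
  · rw [one_mul, mul_comm]
  rcases hd0.eq_or_lt with rfl | hd
  · simp [hL0]
  rcases hd1.eq_or_lt with rfl | hd'
  · rw [mul_one]
  have hL1 : 0 < Real.log (symPow (m + 1) 1) := by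
    apply Real.log_pos
    have : (1 : ℝ) < 2 ^ m := one_lt_pow₀ (by norm_num) hm
    simp only [symPow, sub_self, ne_eq, Nat.add_eq_zero_iff, one_ne_zero, and_false,
      not_false_eq_true, zero_pow, add_zero]
    rw [one_add_one_eq_two, pow_succ]
    linarith
  set L := fun x => Real.log (symPow (m + 1) x) with hLdef
  -- This choice makes p L(x) - L(ax) vanish at x = 1 as well as at x = 0.
  set p := L a / L 1 with hp
  set L' := fun x => (((m + 1 : ℕ) : ℝ) * ((1 + x) ^ m - (1 - x) ^ m) / 2) / symPow (m + 1) x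
    with hL'
  have hder : ∀ x ∈ Set.Icc (0 : ℝ) 1,
      HasDerivAt (fun x => p * L x - L (a * x)) (p * L' x - L' (a * x) * a) x := by
    intro x hx
    have h1 : HasDerivAt (fun x => a * x) a x := by simpa using (hasDerivAt_id x).const_mul a
    have h2 := (hasDerivAt_log_symPow m (x := a * x) (mul_nonneg ha.le hx.1)
      (by nlinarith [hx.1, hx.2])).comp x h1
    exact ((hasDerivAt_log_symPow m hx.1 hx.2).const_mul p).sub h2
  have hcont : ∀ u v, 0 ≤ u → v ≤ 1 →
      ContinuousOn (fun x => p * L x - L (a * x)) (Set.Icc u v) := fun u v hu hv x hx =>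
    (hder x ⟨hu.trans hx.1, hx.2.trans hv⟩).continuousAt.continuousWithinAt
  have hpos : 0 ≤ p * L d - L (a * d) := by
    -- A negative value at d forces, by the mean value theorem, a negative derivative at some x < d
    -- and a positive one at some y > d. Hence a L'(ax)/L'(x) > p > a L'(ay)/L'(y), against
    -- monotonicity.
    by_contra! hneg
    obtain ⟨x, hx, hx'⟩ := exists_hasDerivAt_eq_slope (fun x => p * L x - L (a * x))
      (fun x => p * L' x - L' (a * x) * a) hd (hcont 0 d le_rfl hd'.le)
      (fun x hx => hder x ⟨hx.1.le, hx.2.le.trans hd'.le⟩)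
    obtain ⟨y, hy, hy'⟩ := exists_hasDerivAt_eq_slope (fun x => p * L x - L (a * x))
      (fun x => p * L' x - L' (a * x) * a) hd' (hcont d 1 hd.le le_rfl)
      (fun x hx => hder x ⟨hd.le.trans hx.1.le, hx.2.le⟩)
    have h0 : p * L 0 - L (a * 0) = 0 := by
      have : L 0 = 0 := hL0
      rw [mul_zero, this]; ring
    have h1 : p * L 1 - L (a * 1) = 0 := by
      rw [mul_one, hp, div_mul_cancel₀ _ hL1.ne', sub_self]
    have hxneg : p * L' x - L' (a * x) * a < 0 := by
      rw [hx', h0]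
      exact div_neg_of_neg_of_pos (by linarith) (by linarith)
    have hypos : 0 < p * L' y - L' (a * y) * a := by
      rw [hy', h1]
      exact div_pos (by linarith) (by linarith)
    have hxm : x ∈ Set.Ioo (0 : ℝ) 1 := ⟨hx.1, hx.2.trans hd'⟩
    have hym : y ∈ Set.Ioo (0 : ℝ) 1 := ⟨hd.trans hy.1, hy.2⟩
    have hmem : ∀ x ∈ Set.Ioo (0 : ℝ) 1, a * x ∈ Set.Ioo (0 : ℝ) 1 := fun x hx =>
      ⟨mul_pos ha hx.1, by nlinarith [hx.1, hx.2]⟩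
    have e1 : ∀ x ∈ Set.Ioo (0 : ℝ) 1,
        L' x = ((m + 1 : ℕ) : ℝ) * tanhMul m x / (1 + x * tanhMul m x) :=
      fun x hx => deriv_log_symPow_eq hx
    have hmono := monotoneOn_dilation_ratio (fun x hx => hasDerivAt_tanhMul m hx)
      (fun x hx => tanhMul_pos hm hx) (antitoneOn_log_deriv_tanhMul hm) ha ha' hxm hym
      (hx.2.trans hy.1).le
    simp only at hmono
    have tx := tanhMul_pos hm hxm
    have ty := tanhMul_pos hm hym
    have tax := tanhMul_pos hm (hmem x hxm)
    have tay := tanhMul_pos hm (hmem y hym)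
    have hxy : tanhMul m x ≤ tanhMul m y := monotoneOn_tanhMul m hxm hym (hx.2.trans hy.1).le
    have hay : tanhMul m (a * y) ≤ tanhMul m y :=
      monotoneOn_tanhMul m (hmem y hym) hym (by nlinarith [hym.1])
    rw [e1 x hxm, e1 _ (hmem x hxm)] at hxneg
    rw [e1 y hym, e1 _ (hmem y hym)] at hypos
    have hsxy : tanhMul m (a * x) ≤ tanhMul m (a * y) :=
      monotoneOn_tanhMul m (hmem x hxm) (hmem y hym) (by nlinarith [hx.2.trans hy.1])
    have hxy' : x ≤ y := (hx.2.trans hy.1).le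
    have hM : (0 : ℝ) < ((m + 1 : ℕ) : ℝ) := by positivity
    clear_value p
    generalize ((m + 1 : ℕ) : ℝ) = M at *
    generalize tanhMul m (a * x) = sx at *
    generalize tanhMul m (a * y) = sy at *
    generalize tanhMul m x = rx at *
    generalize tanhMul m y = ry at *
    have hx0 := hxm.1
    have hy0 := hym.1
    have q1 : p * (rx * (1 + a * x * sx)) < a * sx * (1 + x * rx) := by
      have : p * (M * rx / (1 + x * rx)) < M * sx / (1 + a * x * sx) * a := by linarith
      rw [mul_div_assoc', div_mul_eq_mul_div, div_lt_div_iff₀ (by positivity) (by positivity)] at this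
      have : M * (p * (rx * (1 + a * x * sx))) < M * (a * sx * (1 + x * rx)) := by linarith
      exact lt_of_mul_lt_mul_left this hM.le
    have q2 : a * sy * (1 + y * ry) < p * (ry * (1 + a * y * sy)) := by
      have : M * sy / (1 + a * y * sy) * a < p * (M * ry / (1 + y * ry)) := by linarith
      rw [mul_div_assoc', div_mul_eq_mul_div, div_lt_div_iff₀ (by positivity) (by positivity)] at this
      have : M * (a * sy * (1 + y * ry)) < M * (p * (ry * (1 + a * y * sy))) := by linarith
      exact lt_of_mul_lt_mul_left this hM.le
    rw [div_le_div_iff₀ tx ty] at hmono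
    -- Eliminating p from `q1` and `q2` leaves a comparison of the two ratios. Its highest-order
    -- terms cancel; the lowest-order terms contradict it by `hmono`, the middle ones by `c2`.
    have c1 : a * sy * (1 + y * ry) * (rx * (1 + a * x * sx)) <
        a * sx * (1 + x * rx) * (ry * (1 + a * y * sy)) := by
      have r1 := mul_lt_mul_of_pos_right q2 (show 0 < rx * (1 + a * x * sx) by positivity)
      have r2 := mul_lt_mul_of_pos_right q1 (show 0 < ry * (1 + a * y * sy) by positivity)
      linarith
    have c2 : x * sx * ((ry - a * sy) * rx) ≤ y * sy * ((rx - a * sx) * ry) := by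
      have r1 : (ry - a * sy) * rx ≤ (rx - a * sx) * ry := by
        linarith [mul_le_mul_of_nonneg_left hmono ha.le]
      have r2 : 0 ≤ (ry - a * sy) * rx := by
        apply mul_nonneg _ tx.le
        linarith [mul_le_mul_of_nonneg_right ha'.le tay.le]
      exact mul_le_mul (mul_le_mul hxy' hsxy tax.le hy0.le) r1 r2 (by positivity)
    have c3 := mul_le_mul_of_nonneg_left c2 ha.le
    have c4 := mul_le_mul_of_nonneg_left hmono ha.le
    linarith
  have : p * L d = L a * L d / L 1 := by rw [hp]; ring
  rw [this, sub_nonneg, le_div_iff₀ hL1] at hpos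
  exact hpos

/-! ### Two-point inequalities for the noise operator -/

/-- The exponent λ(q, ε) is exactly the ratio of the log-moments at 1 - 2ε and at 1, since `symPow q
(1 - 2 * ε)` is 2^(q-1) (ε^q + (1-ε)^q) and `symPow q 1` is 2^(q-1). -/
theorem noiseLambda_mul_log_symPow_one {q : ℕ} (hq : 2 ≤ q) {ε : ℝ} (h0 : 0 ≤ ε) (h1 : ε ≤ 1 / 2) :
    noiseLambda q ε * Real.log (symPow q 1) = Real.log (symPow q (1 - 2 * ε)) := by
  have hq1 : (0 : ℝ) < (q : ℝ) - 1 := by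
    have : (2 : ℝ) ≤ q := by exact_mod_cast hq
    linarith
  have hs1 : symPow q 1 = 2 ^ q / 2 := by
    have : q ≠ 0 := by omega
    simp [symPow, this, one_add_one_eq_two]
  have hs : symPow q (1 - 2 * ε) = 2 ^ q / 2 * (ε ^ q + (1 - ε) ^ q) := by
    have e1 : 1 + (1 - 2 * ε) = 2 * (1 - ε) := by ring
    have e2 : 1 - (1 - 2 * ε) = 2 * ε := by ring
    rw [symPow, e1, e2, mul_pow, mul_pow]
    ring
  have hp : 0 < ε ^ q + (1 - ε) ^ q := by
    have : 0 < (1 - ε) ^ q := pow_pos (by linarith) q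
    positivity
  have hl : Real.log (2 ^ q / 2) = (q - 1) * Real.log 2 := by
    rw [Real.log_div (by positivity) (by norm_num), Real.log_pow]
    ring
  have hl2 : Real.log 2 ≠ 0 := (Real.log_pos (by norm_num)).ne'
  rw [hs, hs1, Real.log_mul (by positivity) hp.ne', hl, noiseLambda, Real.logb,
    Real.rpow_natCast, Real.rpow_natCast]
  field_simp

theorem noiseLambda_le_one {q : ℕ} (hq : 2 ≤ q) {ε : ℝ} (h0 : 0 ≤ ε) (h1 : ε ≤ 1 / 2) :
    noiseLambda q ε ≤ 1 := by
  have hq1 : (0 : ℝ) < (q : ℝ) - 1 := by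
    have : (2 : ℝ) ≤ q := by exact_mod_cast hq
    linarith
  have hb : Real.logb 2 (ε ^ (q : ℝ) + (1 - ε) ^ (q : ℝ)) ≤ 0 := by
    rw [Real.rpow_natCast, Real.rpow_natCast]
    apply Real.logb_nonpos (by norm_num)
    · have : 0 ≤ (1 - ε) ^ q := pow_nonneg (by linarith) q
      positivity
    · have e1 := pow_le_of_le_one h0 (by linarith) (show q ≠ 0 by omega)
      have e2 := pow_le_of_le_one (show 0 ≤ 1 - ε by linarith) (by linarith) (show q ≠ 0 by omega)
      linarith
  have : 1 / ((q : ℝ) - 1) * Real.logb 2 (ε ^ (q : ℝ) + (1 - ε) ^ (q : ℝ)) ≤ 0 :=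
    mul_nonpos_of_nonneg_of_nonpos (by positivity) hb
  unfold noiseLambda
  linarith

theorem symPow_mul_le_rpow {q : ℕ} (hq : 2 ≤ q) {a ε : ℝ} (ha0 : 0 ≤ a) (ha1 : a ≤ 1)
    (h0 : 0 ≤ ε) (h1 : ε ≤ 1 / 2) :
    symPow q (a * (1 - 2 * ε)) ≤ symPow q a ^ noiseLambda q ε := by
  obtain ⟨m, rfl⟩ : ∃ m, q = m + 1 := ⟨q - 1, by omega⟩
  have hd0 : 0 ≤ 1 - 2 * ε := by linarith
  have hd1 : 1 - 2 * ε ≤ 1 := by linarith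
  have h := log_symPow_mul_le (show m ≠ 0 by omega) ha0 ha1 hd0 hd1
  rw [← noiseLambda_mul_log_symPow_one hq h0 h1] at h
  have hL1 : 0 < Real.log (symPow (m + 1) 1) := by
    apply Real.log_pos
    have : (1 : ℝ) < 2 ^ m := one_lt_pow₀ (by norm_num) (show m ≠ 0 by omega)
    simp only [symPow, sub_self, ne_eq, Nat.add_eq_zero_iff, one_ne_zero, and_false,
      not_false_eq_true, zero_pow, add_zero]
    rw [one_add_one_eq_two, pow_succ]
    linarith
  have hs := symPow_pos (m + 1) (mul_nonneg ha0 hd0) (mul_le_one₀ ha1 hd0 hd1)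
  rw [← Real.log_le_log_iff hs (Real.rpow_pos_of_pos (symPow_pos _ ha0 ha1) _),
    Real.log_rpow (symPow_pos _ ha0 ha1)]
  rw [← mul_assoc] at h
  have := le_of_mul_le_mul_right h hL1
  linarith

/-- Both sides are homogeneous of degree q, so only the shape of u, v = c(1 ± a) matters. Noise
fixes the mean c and multiplies a by 1 - 2ε, which reduces the claim to `symPow_mul_le_rpow`. -/
theorem two_point_inequality {q : ℕ} (hq : 2 ≤ q) {u v ε : ℝ} (hu : 0 ≤ u) (hv : 0 ≤ v)
    (h0 : 0 ≤ ε) (h1 : ε ≤ 1 / 2) :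
    ((1 - ε) * u + ε * v) ^ q + ((1 - ε) * v + ε * u) ^ q ≤
      (2 * ((u + v) / 2) ^ q) ^ (1 - noiseLambda q ε) * (u ^ q + v ^ q) ^ noiseLambda q ε := by
  wlog huv : v ≤ u generalizing u v
  · have := this hv hu (le_of_not_ge huv)
    rwa [add_comm v u, add_comm (v ^ q), add_comm (((1 - ε) * v + ε * u) ^ q)] at this
  rcases hu.eq_or_lt with rfl | hu0
  · obtain rfl : v = 0 := le_antisymm huv hv
    have : q ≠ 0 := by omega
    simp only [mul_zero, add_zero, ne_eq, this, not_false_eq_true, zero_pow, zero_div]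
    positivity
  set c := (u + v) / 2 with hc
  have hc0 : 0 < c := by positivity
  set a := (u - v) / (u + v) with ha
  have hu' : u = c * (1 + a) := by rw [hc, ha]; field_simp; ring
  have hv' : v = c * (1 - a) := by rw [hc, ha]; field_simp; ring
  have ha0 : 0 ≤ a := div_nonneg (by linarith) (by linarith)
  have ha1 : a ≤ 1 := by rw [ha, div_le_one (by linarith)]; linarith
  have hl : ((1 - ε) * u + ε * v) ^ q + ((1 - ε) * v + ε * u) ^ q =
      2 * c ^ q * symPow q (a * (1 - 2 * ε)) := by
    have e1 : (1 - ε) * u + ε * v = c * (1 + a * (1 - 2 * ε)) := by rw [hu', hv']; ring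
    have e2 : (1 - ε) * v + ε * u = c * (1 - a * (1 - 2 * ε)) := by rw [hu', hv']; ring
    rw [e1, e2, mul_pow, mul_pow, symPow]
    ring
  have hr : u ^ q + v ^ q = 2 * c ^ q * symPow q a := by
    rw [hu', hv', mul_pow, mul_pow, symPow]
    ring
  have hs := symPow_pos q ha0 ha1
  rw [hl, hr, Real.mul_rpow (by positivity) hs.le, ← mul_assoc,
    ← Real.rpow_add (by positivity), sub_add_cancel, Real.rpow_one]
  exact mul_le_mul_of_nonneg_left (symPow_mul_le_rpow hq ha0 ha1 h0 h1) (by positivity)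

theorem noiseLambdaTop_nonneg {ε : ℝ} (h1 : ε ≤ 1 / 2) : 0 ≤ noiseLambdaTop ε := by
  have : Real.logb 2 (2⁻¹) ≤ Real.logb 2 (1 - ε) :=
    Real.logb_le_logb_of_le (by norm_num) (by norm_num) (by linarith)
  rw [Real.logb_inv, Real.logb_self_eq_one (by norm_num)] at this
  unfold noiseLambdaTop
  linarith

theorem noiseLambdaTop_le_one {ε : ℝ} (h0 : 0 ≤ ε) (h1 : ε ≤ 1 / 2) : noiseLambdaTop ε ≤ 1 := by
  have : Real.logb 2 (1 - ε) ≤ 0 :=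
    Real.logb_nonpos (by norm_num) (by linarith) (by linarith)
  unfold noiseLambdaTop
  linarith

theorem one_add_mul_le_rpow_noiseLambdaTop {a ε : ℝ} (ha0 : 0 ≤ a) (ha1 : a ≤ 1)
    (h0 : 0 ≤ ε) (h1 : ε ≤ 1 / 2) :
    1 + a * (1 - 2 * ε) ≤ (1 + a) ^ noiseLambdaTop ε := by
  have hl2 : 0 < Real.log 2 := Real.log_pos (by norm_num)
  set p := Real.log (1 + a) / Real.log 2 with hp
  have hp0 : 0 ≤ p := div_nonneg (Real.log_nonneg (by linarith)) hl2.le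
  have hp1 : p ≤ 1 := by
    rw [hp, div_le_one hl2]
    exact Real.log_le_log (by linarith) (by linarith)
  have h2p : (2 : ℝ) ^ p = 1 + a := by
    rw [hp, Real.rpow_def_of_pos (by norm_num), mul_div_cancel₀ _ hl2.ne', Real.exp_log (by linarith)]
  -- Exchanging base and exponent gives (1 + d)^p with d = 1 - 2ε and 2^p = 1 + a. Concavity of s ↦
  -- s^p between 1 and 2 then bounds it below by 1 + ad.
  have hlam : (1 + a) ^ noiseLambdaTop ε = (1 + (1 - 2 * ε)) ^ p := by
    have e1 : 1 + (1 - 2 * ε) = 2 * (1 - ε) := by ring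
    rw [e1, Real.rpow_def_of_pos (by linarith), Real.rpow_def_of_pos (by linarith),
      Real.log_mul (by norm_num) (by linarith), noiseLambdaTop, Real.logb, hp]
    congr 1
    field_simp
  rw [hlam]
  have hc := (Real.concaveOn_rpow hp0 hp1).2 (show (1 : ℝ) ∈ Set.Ici 0 by simp)
    (show (2 : ℝ) ∈ Set.Ici 0 by simp) (show 0 ≤ 2 * ε by linarith)
    (show 0 ≤ 1 - 2 * ε by linarith) (by ring)
  simp only [smul_eq_mul, mul_one, Real.one_rpow, h2p] at hc
  have e : 2 * ε + (1 - 2 * ε) * 2 = 1 + (1 - 2 * ε) := by ring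
  rw [e] at hc
  linarith

theorem two_point_inequality_top {u v M ε : ℝ} (hu : 0 ≤ u) (hv : 0 ≤ v) (huM : u ≤ M)
    (hvM : v ≤ M) (h0 : 0 ≤ ε) (h1 : ε ≤ 1 / 2) :
    (1 - ε) * u + ε * v ≤ ((u + v) / 2) ^ (1 - noiseLambdaTop ε) * M ^ noiseLambdaTop ε := by
  have hlam := noiseLambdaTop_nonneg h1
  wlog huv : v ≤ u generalizing u v
  -- For u ≤ v, exchanging u and v only increases the left side, because ε ≤ 1/2.
  · refine le_trans ?_ (by simpa only [add_comm v u] using this hv hu hvM huM (le_of_not_ge huv))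
    nlinarith
  rcases hu.eq_or_lt with rfl | hu0
  · obtain rfl : v = 0 := le_antisymm huv hv
    simp only [mul_zero, add_zero, zero_div]
    positivity
  set c := (u + v) / 2 with hc
  have hc0 : 0 < c := by positivity
  set a := (u - v) / (u + v) with ha
  have hu' : u = c * (1 + a) := by rw [hc, ha]; field_simp; ring
  have hv' : v = c * (1 - a) := by rw [hc, ha]; field_simp; ring
  have ha0 : 0 ≤ a := div_nonneg (by linarith) (by linarith)
  have ha1 : a ≤ 1 := by rw [ha, div_le_one (by linarith)]; linarith
  have e1 : (1 - ε) * u + ε * v = c * (1 + a * (1 - 2 * ε)) := by rw [hu', hv']; ring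
  calc (1 - ε) * u + ε * v = c * (1 + a * (1 - 2 * ε)) := e1
    _ ≤ c * (1 + a) ^ noiseLambdaTop ε :=
      mul_le_mul_of_nonneg_left (one_add_mul_le_rpow_noiseLambdaTop ha0 ha1 h0 h1) hc0.le
    _ = c ^ (1 - noiseLambdaTop ε) * u ^ noiseLambdaTop ε := by
      rw [hu', Real.mul_rpow hc0.le (by linarith), ← mul_assoc, ← Real.rpow_add hc0,
        sub_add_cancel, Real.rpow_one]
    _ ≤ _ := mul_le_mul_of_nonneg_left (Real.rpow_le_rpow hu huM hlam) (by positivity)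

/-! ### Hölder's inequality and coordinatewise noise -/

theorem sum_rpow_mul_rpow_le {ι : Type*} (s : Finset ι) {A B : ι → ℝ} (hA : ∀ i, 0 ≤ A i)
    (hB : ∀ i, 0 ≤ B i) {l : ℝ} (h0 : 0 < l) (h1 : l ≤ 1) :
    ∑ i ∈ s, A i ^ (1 - l) * B i ^ l ≤ (∑ i ∈ s, A i) ^ (1 - l) * (∑ i ∈ s, B i) ^ l := by
  rcases h1.eq_or_lt with rfl | h1
  · simp
  have hl : 0 < 1 - l := by linarith
  have hpq : (1 / (1 - l)).HolderConjugate (1 / l) := by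
    rw [Real.holderConjugate_iff]
    refine ⟨by rw [lt_div_iff₀ hl]; linarith, by simp⟩
  have h := Real.inner_le_Lp_mul_Lq_of_nonneg s hpq (f := fun i => A i ^ (1 - l))
    (g := fun i => B i ^ l) (fun i _ => Real.rpow_nonneg (hA i) _)
    (fun i _ => Real.rpow_nonneg (hB i) _)
  have e1 : ∀ i, (A i ^ (1 - l)) ^ (1 / (1 - l)) = A i := fun i => by
    rw [← Real.rpow_mul (hA i), mul_one_div_cancel hl.ne', Real.rpow_one]
  have e2 : ∀ i, (B i ^ l) ^ (1 / l) = B i := fun i => by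
    rw [← Real.rpow_mul (hB i), mul_one_div_cancel h0.ne', Real.rpow_one]
  simpa only [e1, e2, one_div_one_div] using h

/-- The transition probabilities of the binary symmetric channel. -/
noncomputable def flipWeight (t : ℝ) (a b : ZMod 2) : ℝ := if a = b then 1 - t else t

/-- The noise operator with a separate noise parameter for every coordinate. -/
noncomputable def noiseVec {n : ℕ} (e : Fin n → ℝ) (f : Cube n → ℝ) (x : Cube n) : ℝ :=
  ∑ y : Cube n, (∏ i, flipWeight (e i) (y i) (x i)) * f y

theorem prod_flipWeight_const {n : ℕ} (ε : ℝ) (x y : Cube n) :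
    ∏ i, flipWeight ε (y i) (x i) = ε ^ hammingDist y x * (1 - ε) ^ (n - hammingDist y x) := by
  simp only [flipWeight]
  rw [Finset.prod_ite, Finset.prod_const, Finset.prod_const, mul_comm]
  have h := Finset.card_filter_add_card_filter_not (s := (Finset.univ : Finset (Fin n)))
    (fun i => y i = x i)
  rw [Finset.card_univ, Fintype.card_fin] at h
  have hd : hammingDist y x = (Finset.univ.filter (fun i => ¬ y i = x i)).card := rfl
  rw [hd]
  congr 2
  omega

theorem noiseOp_eq_noiseVec {n : ℕ} (ε : ℝ) (f : Cube n → ℝ) :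
    noiseOp ε f = noiseVec (fun _ => ε) f := by
  funext x
  simp only [noiseOp, noiseVec, prod_flipWeight_const]

theorem flipWeight_nonneg {t : ℝ} (h0 : 0 ≤ t) (h1 : t ≤ 1) (a b : ZMod 2) :
    0 ≤ flipWeight t a b := by
  unfold flipWeight
  split_ifs <;> linarith

theorem flipWeight_eq (t : ℝ) (a b : ZMod 2) :
    flipWeight t a b = (1 - t) * flipWeight 0 a b + t * flipWeight 0 a (b + 1) := by
  have h : ∀ a b : ZMod 2, (a = b + 1) ↔ ¬ a = b := by decide
  simp only [flipWeight, h]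
  split_ifs <;> simp_all

theorem sum_comp_flipWeight (F : ℝ → ℝ) (t : ℝ) (a : ZMod 2) :
    ∑ b, F (flipWeight t a b) = F (1 - t) + F t := by
  have h : ∀ a : ZMod 2, a = 0 ∨ a = 1 := by decide
  rw [show (Finset.univ : Finset (ZMod 2)) = {0, 1} from rfl,
    Finset.sum_pair (zero_ne_one' (ZMod 2))]
  rcases h a with rfl | rfl
  · simp [flipWeight]
  · simp [flipWeight, add_comm]

theorem noiseVec_nonneg {n : ℕ} {e : Fin n → ℝ} (he : ∀ i, e i ∈ Set.Icc (0 : ℝ) 1)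
    {f : Cube n → ℝ} (hf : ∀ x, 0 ≤ f x) (x : Cube n) : 0 ≤ noiseVec e f x :=
  Finset.sum_nonneg fun y _ =>
    mul_nonneg (Finset.prod_nonneg fun i _ => flipWeight_nonneg (he i).1 (he i).2 _ _) (hf y)

theorem sum_prod_flipWeight {n : ℕ} (g : Fin n → ZMod 2 → ℝ) :
    ∑ x : Cube n, ∏ i, g i (x i) = ∏ i, ∑ b, g i b :=
  (Fintype.prod_sum g).symm

theorem sum_noiseVec {n : ℕ} (e : Fin n → ℝ) (f : Cube n → ℝ) :
    ∑ x, noiseVec e f x = ∑ x, f x := by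
  simp only [noiseVec]
  rw [Finset.sum_comm]
  refine Finset.sum_congr rfl fun y _ => ?_
  rw [← Finset.sum_mul, sum_prod_flipWeight (fun i b => flipWeight (e i) (y i) b)]
  have : ∀ i, ∑ b, flipWeight (e i) (y i) b = 1 := fun i => by
    simpa using sum_comp_flipWeight id (e i) (y i)
  simp [this]

/-- The channel is affine in its parameter, so noise in coordinate i can be applied after that in
all others. Parameter 0 leaves the coordinate alone, and 1/2 averages it out. -/
theorem noiseVec_update {n : ℕ} (e : Fin n → ℝ) (i : Fin n) (t : ℝ) (f : Cube n → ℝ) (x : Cube n) :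
    noiseVec (Function.update e i t) f x =
      (1 - t) * noiseVec (Function.update e i 0) f x +
        t * noiseVec (Function.update e i 0) f (x + Pi.single i 1) := by
  simp only [noiseVec, Finset.mul_sum, ← Finset.sum_add_distrib]
  refine Finset.sum_congr rfl fun y _ => ?_
  have h : ∀ (s : ℝ) (z : Cube n), (∀ j, j ≠ i → z j = x j) →
      ∏ j, flipWeight (Function.update e i s j) (y j) (z j) =
        flipWeight s (y i) (z i) * ∏ j ∈ Finset.univ.erase i, flipWeight (e j) (y j) (x j) := by
    intro s z hz
    rw [← Finset.mul_prod_erase _ _ (Finset.mem_univ i), Function.update_self]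
    congr 1
    refine Finset.prod_congr rfl fun j hj => ?_
    have hj' := Finset.ne_of_mem_erase hj
    rw [Function.update_of_ne hj', hz j hj']
  rw [h t x fun _ _ => rfl, h 0 x fun _ _ => rfl, h 0 (x + Pi.single i 1) fun j hj => by simp [hj],
    flipWeight_eq t, Pi.add_apply, Pi.single_eq_same]
  ring

theorem add_single_add_single {n : ℕ} (x : Cube n) (i : Fin n) :
    x + Pi.single i 1 + Pi.single i 1 = x := by
  rw [add_assoc, ← Pi.single_add, show (1 : ZMod 2) + 1 = 0 from rfl, Pi.single_zero, add_zero]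

theorem sum_add_single {n : ℕ} (i : Fin n) (g : Cube n → ℝ) :
    ∑ x : Cube n, g (x + Pi.single i 1) = ∑ x, g x :=
  Equiv.sum_comp (Equiv.addRight (Pi.single i 1 : Cube n)) g

/-- The two-point inequality is summed over the edges in direction i by Hölder's inequality. Summing
over vertices counts every edge twice, whence the factor 2 in the proof. -/
theorem sum_pow_noise_coord_le {n q : ℕ} (hq : 2 ≤ q) {ε : ℝ} (h0 : 0 ≤ ε) (h1 : ε ≤ 1 / 2)
    (hl : 0 < noiseLambda q ε) {g : Cube n → ℝ} (hg : ∀ x, 0 ≤ g x) (i : Fin n) :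
    ∑ x : Cube n, ((1 - ε) * g x + ε * g (x + Pi.single i 1)) ^ q ≤
      (∑ x : Cube n, ((1 - 1 / 2) * g x + 1 / 2 * g (x + Pi.single i 1)) ^ q) ^ (1 - noiseLambda q ε) *
        (∑ x, g x ^ q) ^ noiseLambda q ε := by
  have e1 := sum_add_single i (fun x => ((1 - ε) * g x + ε * g (x + Pi.single i 1)) ^ q)
  have e2 := sum_add_single i (fun x => g x ^ q)
  simp only [add_single_add_single] at e1 e2
  have hS : 0 ≤ ∑ x : Cube n, ((1 - 1 / 2) * g x + 1 / 2 * g (x + Pi.single i 1)) ^ q :=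
    Finset.sum_nonneg fun x _ => by
      have := hg x
      have := hg (x + Pi.single i 1)
      apply pow_nonneg
      linarith
  have hS' : 0 ≤ ∑ x, g x ^ q := Finset.sum_nonneg fun x _ => pow_nonneg (hg x) q
  have h2 : 2 * ∑ x : Cube n, ((1 - ε) * g x + ε * g (x + Pi.single i 1)) ^ q ≤
      2 * ((∑ x : Cube n, ((1 - 1 / 2) * g x + 1 / 2 * g (x + Pi.single i 1)) ^ q) ^ (1 - noiseLambda q ε) *
        (∑ x, g x ^ q) ^ noiseLambda q ε) := by
    calc 2 * ∑ x : Cube n, ((1 - ε) * g x + ε * g (x + Pi.single i 1)) ^ q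
        = ∑ x, (((1 - ε) * g x + ε * g (x + Pi.single i 1)) ^ q +
            ((1 - ε) * g (x + Pi.single i 1) + ε * g x) ^ q) := by
          rw [Finset.sum_add_distrib, e1]; ring
      _ ≤ ∑ x, (2 * ((g x + g (x + Pi.single i 1)) / 2) ^ q) ^ (1 - noiseLambda q ε) *
            (g x ^ q + g (x + Pi.single i 1) ^ q) ^ noiseLambda q ε :=
          Finset.sum_le_sum fun x _ => two_point_inequality hq (hg x) (hg _) h0 h1
      _ ≤ (∑ x, 2 * ((g x + g (x + Pi.single i 1)) / 2) ^ q) ^ (1 - noiseLambda q ε) *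
            (∑ x, (g x ^ q + g (x + Pi.single i 1) ^ q)) ^ noiseLambda q ε := by
          apply sum_rpow_mul_rpow_le _ _ _ hl (noiseLambda_le_one hq h0 h1)
          · intro x
            have := hg x
            have := hg (x + Pi.single i 1)
            positivity
          · intro x
            have := hg x
            have := hg (x + Pi.single i 1)
            positivity
      _ = _ := by
          rw [Finset.sum_add_distrib, e2, ← two_mul, ← Finset.mul_sum]
          have e3 : ∀ x, (g x + g (x + Pi.single i 1)) / 2 =
              (1 - 1 / 2) * g x + 1 / 2 * g (x + Pi.single i 1) := fun x => by ring
          simp only [e3]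
          rw [Real.mul_rpow (by norm_num) hS, Real.mul_rpow (by norm_num) hS']
          have e4 : (2 : ℝ) ^ (1 - noiseLambda q ε) * 2 ^ noiseLambda q ε = 2 := by
            rw [← Real.rpow_add (by norm_num), sub_add_cancel, Real.rpow_one]
          linear_combination
            ((∑ x : Cube n, ((1 - 1 / 2) * g x + 1 / 2 * g (x + Pi.single i 1)) ^ q) ^
              (1 - noiseLambda q ε) * (∑ x, g x ^ q) ^ noiseLambda q ε) * e4
  linarith

/-! ### Random subsets and replacement of noise by erasures -/

/-- The expectation of `g T` for a random subset `T` of `s` in which each element is chosen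
independently with probability `p`. -/
noncomputable def subsetExp {n : ℕ} (s : Finset (Fin n)) (p : ℝ) (g : Finset (Fin n) → ℝ) : ℝ :=
  ∑ T ∈ s.powerset, p ^ T.card * (1 - p) ^ (s.card - T.card) * g T

theorem subsetExp_univ {n : ℕ} (p : ℝ) (g : Finset (Fin n) → ℝ) :
    subsetExp Finset.univ p g = expectRandomSubset p g := by
  simp [subsetExp, expectRandomSubset]

theorem subsetExp_insert {n : ℕ} {s : Finset (Fin n)} {i : Fin n} (hi : i ∉ s) (p : ℝ)
    (g : Finset (Fin n) → ℝ) :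
    subsetExp (insert i s) p g =
      (1 - p) * subsetExp s p g + p * subsetExp s p (fun T => g (insert i T)) := by
  simp only [subsetExp, Finset.sum_powerset_insert hi, Finset.mul_sum]
  congr 1
  · refine Finset.sum_congr rfl fun T hT => ?_
    have := Finset.card_le_card (Finset.mem_powerset.1 hT)
    rw [Finset.card_insert_of_notMem hi, show s.card + 1 - T.card = s.card - T.card + 1 by omega,
      pow_succ]
    ring
  · refine Finset.sum_congr rfl fun T hT => ?_
    have hT' : i ∉ T := fun h => hi (Finset.mem_powerset.1 hT h)
    rw [Finset.card_insert_of_notMem hi, Finset.card_insert_of_notMem hT',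
      show s.card + 1 - (T.card + 1) = s.card - T.card by omega, pow_succ]
    ring

theorem subsetExp_add {n : ℕ} (s : Finset (Fin n)) (p : ℝ) (g h : Finset (Fin n) → ℝ) :
    subsetExp s p (fun T => g T + h T) = subsetExp s p g + subsetExp s p h := by
  simp only [subsetExp, mul_add, Finset.sum_add_distrib]

theorem subsetExp_mul_left {n : ℕ} (s : Finset (Fin n)) (p c : ℝ) (g : Finset (Fin n) → ℝ) :
    subsetExp s p (fun T => c * g T) = c * subsetExp s p g := by
  simp only [subsetExp, Finset.mul_sum]
  exact Finset.sum_congr rfl fun T _ => by ring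

theorem subsetExp_mono {n : ℕ} {s : Finset (Fin n)} {p : ℝ} (h0 : 0 ≤ p) (h1 : p ≤ 1)
    {g h : Finset (Fin n) → ℝ} (hgh : ∀ T ⊆ s, g T ≤ h T) : subsetExp s p g ≤ subsetExp s p h :=
  Finset.sum_le_sum fun T hT => mul_le_mul_of_nonneg_left (hgh T (Finset.mem_powerset.1 hT))
    (mul_nonneg (pow_nonneg h0 _) (pow_nonneg (by linarith) _))

theorem subsetExp_const {n : ℕ} (s : Finset (Fin n)) (p c : ℝ) :
    subsetExp s p (fun _ => c) = c := by
  induction s using Finset.induction_on with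
  | empty => simp [subsetExp]
  | insert i s hi ih => rw [subsetExp_insert hi, ih]; ring

theorem subsetExp_card {n : ℕ} (s : Finset (Fin n)) (p : ℝ) :
    subsetExp s p (fun T => (T.card : ℝ)) = p * s.card := by
  induction s using Finset.induction_on with
  | empty => simp [subsetExp]
  | insert i s hi ih =>
    have h : subsetExp s p (fun T => ((insert i T).card : ℝ)) =
        subsetExp s p (fun T => (T.card : ℝ) + 1) := by
      refine Finset.sum_congr rfl fun T hT => ?_
      have hT' : i ∉ T := fun h => hi (Finset.mem_powerset.1 hT h)
      simp only
      rw [Finset.card_insert_of_notMem hT']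
      push_cast
      ring
    rw [subsetExp_insert hi, h, subsetExp_add, subsetExp_const, ih, Finset.card_insert_of_notMem hi]
    push_cast
    ring

/-- Raising the probability of an element i moves weight from T to T ∪ {i}, where g is at least as
large. -/
theorem subsetExp_le_of_le {n : ℕ} (s : Finset (Fin n)) {p p' : ℝ} (h0 : 0 ≤ p) (hp : p ≤ p')
    (h1 : p' ≤ 1) {g : Finset (Fin n) → ℝ} (hg : Monotone g) :
    subsetExp s p g ≤ subsetExp s p' g := by
  induction s using Finset.induction_on generalizing g with
  | empty => simp [subsetExp]
  | insert i s hi ih =>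
    have hg' : Monotone fun T => g (insert i T) := fun T T' h => hg (Finset.insert_subset_insert i h)
    have i1 := ih hg
    have i2 := ih hg'
    have i3 : subsetExp s p' g ≤ subsetExp s p' (fun T => g (insert i T)) :=
      subsetExp_mono (h0.trans hp) h1 fun T _ => hg (Finset.subset_insert i T)
    rw [subsetExp_insert hi, subsetExp_insert hi]
    nlinarith [mul_le_mul_of_nonneg_left i1 (show 0 ≤ 1 - p by linarith),
      mul_le_mul_of_nonneg_left i2 h0, mul_nonneg (sub_nonneg.2 hp) (sub_nonneg.2 i3)]

/-- The noise parameters of the conditional expectation on `T` in the coordinates in `s`, and `ε`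
elsewhere. -/
noncomputable def condVec {n : ℕ} (s T : Finset (Fin n)) (ε : ℝ) (i : Fin n) : ℝ :=
  if i ∈ s then (if i ∈ T then 0 else 1 / 2) else ε

theorem condVec_mem_Icc {n : ℕ} (s T : Finset (Fin n)) {ε : ℝ} (h0 : 0 ≤ ε) (h1 : ε ≤ 1 / 2)
    (i : Fin n) : condVec s T ε i ∈ Set.Icc (0 : ℝ) 1 := by
  unfold condVec
  split_ifs <;> constructor <;> linarith

/-- Coordinates are treated one at a time: parameter ε is replaced by 0 with probability l and by
1/2 with probability 1 - l. The functional Ψ is left general so as to serve finite q and q = ∞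
alike. -/
theorem le_subsetExp_condVec {n : ℕ} {Ψ : (Fin n → ℝ) → ℝ} {ε l : ℝ} (h0 : 0 ≤ ε) (h1 : ε ≤ 1 / 2)
    (hl0 : 0 ≤ l) (hl1 : l ≤ 1)
    (hΨ : ∀ (e : Fin n → ℝ) (i : Fin n), (∀ j, e j ∈ Set.Icc (0 : ℝ) 1) →
      Ψ (Function.update e i ε) ≤
        (1 - l) * Ψ (Function.update e i (1 / 2)) + l * Ψ (Function.update e i 0))
    (s : Finset (Fin n)) :
    Ψ (fun _ => ε) ≤ subsetExp s l (fun T => Ψ (condVec s T ε)) := by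
  induction s using Finset.induction_on with
  | empty =>
    have : condVec ∅ ∅ ε = fun _ : Fin n => ε := by
      funext i
      simp [condVec]
    simp [subsetExp, this]
  | insert i s hi ih =>
    refine ih.trans ?_
    rw [subsetExp_insert hi, ← subsetExp_mul_left, ← subsetExp_mul_left, ← subsetExp_add]
    apply subsetExp_mono hl0 hl1
    intro T hT
    have hiT : i ∉ T := fun h => hi (hT h)
    have e1 : condVec s T ε = Function.update (condVec s T ε) i ε := by
      symm
      apply Function.update_eq_self_iff.2
      simp [condVec, hi]
    have e2 : condVec (insert i s) T ε = Function.update (condVec s T ε) i (1 / 2) := by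
      funext j
      rcases eq_or_ne j i with rfl | hj
      · simp [condVec, hiT]
      · simp [condVec, hj]
    have e3 : condVec (insert i s) (insert i T) ε = Function.update (condVec s T ε) i 0 := by
      funext j
      rcases eq_or_ne j i with rfl | hj
      · simp [condVec]
      · simp [condVec, hj]
    rw [e2, e3]
    conv_lhs => rw [e1]
    exact hΨ _ i (condVec_mem_Icc s T h0 h1)

theorem exists_noiseVec_pos {n : ℕ} (e : Fin n → ℝ) {f : Cube n → ℝ} (hf : ∀ x, 0 ≤ f x)
    (hf0 : f ≠ 0) : ∃ x, 0 < noiseVec e f x := by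
  obtain ⟨z, hz⟩ := Function.ne_iff.1 hf0
  have hpos : 0 < ∑ x, f x :=
    Finset.sum_pos' (fun x _ => hf x) ⟨z, Finset.mem_univ z, lt_of_le_of_ne (hf z) (Ne.symm hz)⟩
  rw [← sum_noiseVec e f] at hpos
  by_contra! h
  exact absurd hpos (not_lt.2 (Finset.sum_nonpos fun x _ => h x))

theorem update_mem_Icc {n : ℕ} {e : Fin n → ℝ} (he : ∀ j, e j ∈ Set.Icc (0 : ℝ) 1) (i : Fin n)
    {t : ℝ} (ht : t ∈ Set.Icc (0 : ℝ) 1) (j : Fin n) :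
    Function.update e i t j ∈ Set.Icc (0 : ℝ) 1 := by
  rcases eq_or_ne j i with rfl | hj
  · simpa using ht
  · simpa [hj] using he j

theorem sum_noiseVec_rpow_pos {n : ℕ} {e : Fin n → ℝ} (he : ∀ j, e j ∈ Set.Icc (0 : ℝ) 1)
    {f : Cube n → ℝ} (hf : ∀ x, 0 ≤ f x) (hf0 : f ≠ 0) (q : ℝ) :
    0 < ∑ x, noiseVec e f x ^ q := by
  obtain ⟨x, hx⟩ := exists_noiseVec_pos e hf hf0
  exact Finset.sum_pos' (fun x _ => Real.rpow_nonneg (noiseVec_nonneg he hf x) q)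
    ⟨x, Finset.mem_univ x, Real.rpow_pos_of_pos hx q⟩

theorem sum_noiseVec_pow_pos {n : ℕ} {e : Fin n → ℝ} (he : ∀ j, e j ∈ Set.Icc (0 : ℝ) 1)
    {f : Cube n → ℝ} (hf : ∀ x, 0 ≤ f x) (hf0 : f ≠ 0) (q : ℕ) :
    0 < ∑ x, noiseVec e f x ^ q := by
  simpa only [Real.rpow_natCast] using sum_noiseVec_rpow_pos he hf hf0 (q : ℝ)

theorem logb_le_of_le_rpow_mul_rpow {a b c l : ℝ} (ha : 0 < a) (hb : 0 < b) (hc : 0 < c)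
    (h : a ≤ b ^ (1 - l) * c ^ l) :
    Real.logb 2 a ≤ (1 - l) * Real.logb 2 b + l * Real.logb 2 c := by
  refine (Real.logb_le_logb_of_le (by norm_num) ha h).trans_eq ?_
  rw [Real.logb_mul (by positivity) (by positivity), Real.logb_rpow_eq_mul_logb_of_pos hb,
    Real.logb_rpow_eq_mul_logb_of_pos hc]

/-- The logarithm of the `q`-norm of `T_ε f` is bounded by the expected logarithm of the `q`-norm
of the conditional expectation of `f` on a random subset of the coordinates. -/
theorem logb_sum_noiseOp_pow_le {n q : ℕ} (hq : 2 ≤ q) {ε : ℝ} (h0 : 0 ≤ ε) (h1 : ε ≤ 1 / 2)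
    (hl : 0 < noiseLambda q ε) {f : Cube n → ℝ} (hf : ∀ x, 0 ≤ f x) (hf0 : f ≠ 0) :
    Real.logb 2 (∑ x, noiseOp ε f x ^ q) ≤ subsetExp Finset.univ (noiseLambda q ε)
      (fun T => Real.logb 2 (∑ x, noiseVec (condVec Finset.univ T ε) f x ^ q)) := by
  rw [noiseOp_eq_noiseVec]
  refine le_subsetExp_condVec (Ψ := fun e => Real.logb 2 (∑ x, noiseVec e f x ^ q)) h0 h1 hl.le
    (noiseLambda_le_one hq h0 h1) ?_ Finset.univ
  intro e i he
  have m0 := update_mem_Icc he i (t := 0) (by norm_num)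
  have m1 := update_mem_Icc he i (t := 1 / 2) (by norm_num)
  have m2 := update_mem_Icc he i (t := ε) ⟨h0, by linarith⟩
  apply logb_le_of_le_rpow_mul_rpow (sum_noiseVec_pow_pos m2 hf hf0 q)
    (sum_noiseVec_pow_pos m1 hf hf0 q) (sum_noiseVec_pow_pos m0 hf hf0 q)
  have h := sum_pow_noise_coord_le hq h0 h1 hl (g := noiseVec (Function.update e i 0) f)
    (noiseVec_nonneg m0 hf) i
  simpa only [← noiseVec_update e i] using h

theorem le_cubeSupNorm {n : ℕ} (f : Cube n → ℝ) (x : Cube n) : |f x| ≤ cubeSupNorm f :=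
  le_ciSup (f := fun x => |f x|) (Set.finite_range _).bddAbove x

theorem cubeSupNorm_noiseVec_pos {n : ℕ} (e : Fin n → ℝ) {f : Cube n → ℝ} (hf : ∀ x, 0 ≤ f x)
    (hf0 : f ≠ 0) : 0 < cubeSupNorm (noiseVec e f) := by
  obtain ⟨x, hx⟩ := exists_noiseVec_pos e hf hf0
  exact hx.trans_le ((le_abs_self _).trans (le_cubeSupNorm _ x))

/-- The two-point bound is used at each x: the mean over an edge is a value of the function with
parameter 1/2 in coordinate i, hence at most its supremum. -/
theorem logb_cubeSupNorm_noiseOp_le {n : ℕ} {ε : ℝ} (h0 : 0 ≤ ε) (h1 : ε ≤ 1 / 2)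
    {f : Cube n → ℝ} (hf : ∀ x, 0 ≤ f x) (hf0 : f ≠ 0) :
    Real.logb 2 (cubeSupNorm (noiseOp ε f)) ≤ subsetExp Finset.univ (noiseLambdaTop ε)
      (fun T => Real.logb 2 (cubeSupNorm (noiseVec (condVec Finset.univ T ε) f))) := by
  have hl0 := noiseLambdaTop_nonneg h1
  have hl1 := noiseLambdaTop_le_one h0 h1
  rw [noiseOp_eq_noiseVec]
  refine le_subsetExp_condVec (Ψ := fun e => Real.logb 2 (cubeSupNorm (noiseVec e f))) h0 h1 hl0
    hl1 ?_ Finset.univ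
  intro e i he
  have m0 := update_mem_Icc he i (t := 0) (by norm_num)
  have m1 := update_mem_Icc he i (t := 1 / 2) (by norm_num)
  have m2 := update_mem_Icc he i (t := ε) ⟨h0, by linarith⟩
  apply logb_le_of_le_rpow_mul_rpow (cubeSupNorm_noiseVec_pos _ hf hf0)
    (cubeSupNorm_noiseVec_pos _ hf hf0) (cubeSupNorm_noiseVec_pos _ hf hf0)
  refine ciSup_le fun x => ?_
  rw [abs_of_nonneg (noiseVec_nonneg m2 hf x), noiseVec_update]
  refine (two_point_inequality_top (noiseVec_nonneg m0 hf x) (noiseVec_nonneg m0 hf _)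
    ((le_abs_self _).trans (le_cubeSupNorm _ x)) ((le_abs_self _).trans (le_cubeSupNorm _ _))
    h0 h1).trans ?_
  apply mul_le_mul_of_nonneg_right _ (Real.rpow_nonneg (cubeSupNorm_noiseVec_pos _ hf hf0).le _)
  apply Real.rpow_le_rpow _ _ (by linarith)
  · have := noiseVec_nonneg m0 hf x
    have := noiseVec_nonneg m0 hf (x + Pi.single i 1)
    positivity
  · refine le_trans (le_of_eq ?_) ((le_abs_self _).trans
      (le_cubeSupNorm (noiseVec (Function.update e i (1 / 2)) f) x))
    rw [noiseVec_update e i (1 / 2)]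
    ring

/-! ### Rank function and conditional expectations of a code -/

/-- The restriction of the codewords of `C` to the coordinates in `T`. -/
def codeRestrict {n : ℕ} (C : BinaryLinearCode n) (T : Finset (Fin n)) :
    C →ₗ[ZMod 2] (T → ZMod 2) :=
  (LinearMap.funLeft (ZMod 2) (ZMod 2) (fun j : T => (j : Fin n))).comp C.subtype

theorem codeRank_eq_finrank_range {n : ℕ} (C : BinaryLinearCode n) (T : Finset (Fin n)) :
    codeRank C T = Module.finrank (ZMod 2) (LinearMap.range (codeRestrict C T)) := by
  rw [codeRank, columnRank_eq_finrank_map (generatingMatrix_isGeneratingMatrix C), codeRestrict,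
    LinearMap.range_comp, Submodule.range_subtype]

theorem card_ker_mul_two_pow_codeRank {n : ℕ} (C : BinaryLinearCode n) (T : Finset (Fin n)) :
    Nat.card (LinearMap.ker (codeRestrict C T)) * 2 ^ codeRank C T = Nat.card C := by
  rw [Module.natCard_eq_pow_finrank (K := ZMod 2) (V := C),
    Module.natCard_eq_pow_finrank (K := ZMod 2) (V := LinearMap.ker (codeRestrict C T)),
    Nat.card_zmod, codeRank_eq_finrank_range, ← pow_add, add_comm,
    LinearMap.finrank_range_add_finrank_ker]

/-- The codewords agreeing with x on T form either the empty set or a coset of the kernel of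
restriction to T. -/
theorem card_filter_mul_two_pow_codeRank_le {n : ℕ} (C : BinaryLinearCode n) (T : Finset (Fin n))
    (x : Cube n) :
    Nat.card {y : C // ∀ i ∈ T, (y : Cube n) i = x i} * 2 ^ codeRank C T ≤ Nat.card C := by
  rw [← card_ker_mul_two_pow_codeRank C T]
  apply Nat.mul_le_mul_right
  rcases isEmpty_or_nonempty {y : C // ∀ i ∈ T, (y : Cube n) i = x i} with h | ⟨⟨z, hz⟩⟩
  · simp
  · refine Nat.card_le_card_of_injective (fun y => ⟨y.1 - z, ?_⟩) ?_
    · rw [LinearMap.mem_ker]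
      funext i
      show (y.1 : Cube n) i - (z : Cube n) i = 0
      rw [y.2 i i.2, hz i i.2, sub_self]
    · intro y y' h
      have := congrArg Subtype.val h
      exact Subtype.ext (sub_left_injective this)

theorem codeRank_mono {n : ℕ} (C : BinaryLinearCode n) : Monotone (codeRank C) := by
  intro T T' h
  have hle : LinearMap.ker (codeRestrict C T') ≤ LinearMap.ker (codeRestrict C T) := by
    intro y hy
    rw [LinearMap.mem_ker] at hy ⊢
    funext i
    exact congrFun hy ⟨i, h i.2⟩
  have h1 := Submodule.finrank_mono hle
  have h2 := LinearMap.finrank_range_add_finrank_ker (codeRestrict C T)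
  have h3 := LinearMap.finrank_range_add_finrank_ker (codeRestrict C T')
  rw [codeRank_eq_finrank_range, codeRank_eq_finrank_range]
  omega

/-- The mean of |T| is exactly pn, while the mean rank does not decrease as p grows. -/
theorem expect_card_sub_codeRank_le {n : ℕ} (C : BinaryLinearCode n) {p p' : ℝ} (h0 : 0 ≤ p)
    (hp : p ≤ p') (h1 : p' ≤ 1) :
    subsetExp Finset.univ p' (fun T => (T.card : ℝ) - (codeRank C T : ℝ)) ≤
      expectRandomSubset p (fun T => (T.card : ℝ) - (codeRank C T : ℝ)) + (p' - p) * n := by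
  have h : ∀ p, subsetExp Finset.univ p (fun T => (T.card : ℝ) - (codeRank C T : ℝ)) =
      p * n - subsetExp Finset.univ p (fun T => (codeRank C T : ℝ)) := by
    intro p
    have := subsetExp_add Finset.univ p (fun T => (T.card : ℝ))
      (fun T => (-1) * (codeRank C T : ℝ))
    rw [subsetExp_mul_left, subsetExp_card, Finset.card_univ, Fintype.card_fin] at this
    simp only [neg_one_mul, ← sub_eq_add_neg] at this
    exact this
  have hm := subsetExp_le_of_le Finset.univ h0 hp h1 (g := fun T => (codeRank C T : ℝ))
    (fun T T' hT => Nat.cast_le.2 (codeRank_mono C hT))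
  rw [← subsetExp_univ, h, h]
  linarith

theorem codeFun_nonneg {n : ℕ} (C : BinaryLinearCode n) (x : Cube n) : 0 ≤ codeFun C x :=
  Set.indicator_nonneg (fun _ _ => by positivity) x

theorem codeFun_ne_zero {n : ℕ} (C : BinaryLinearCode n) : codeFun C ≠ 0 := by
  intro h
  have h0 := congrFun h 0
  have hc : Nat.card C ≠ 0 := Nat.card_pos.ne'
  rw [codeFun, Set.indicator_of_mem (by simp)] at h0
  simp [hc] at h0

theorem sum_codeFun {n : ℕ} (C : BinaryLinearCode n) : ∑ x, codeFun C x = 2 ^ n := by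
  classical
  have hc : (Nat.card C : ℝ) ≠ 0 := by exact_mod_cast Nat.card_pos.ne'
  simp only [codeFun, Set.indicator_apply]
  rw [← Finset.sum_filter, Finset.sum_const, nsmul_eq_mul, ← Fintype.card_subtype,
    ← Nat.card_eq_fintype_card]
  exact mul_div_cancel₀ _ hc

/-- The value at x is 2^|T|/|C| times the number of codewords agreeing with x on T, and that number
is at most |C|/2^(r_C(T)). -/
theorem noiseVec_condVec_codeFun_le {n : ℕ} (C : BinaryLinearCode n) (T : Finset (Fin n)) (ε : ℝ)
    (x : Cube n) :
    noiseVec (condVec Finset.univ T ε) (codeFun C) x ≤ 2 ^ T.card / 2 ^ codeRank C T := by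
  classical
  have hw : ∀ y : Cube n, ∏ i, flipWeight (condVec Finset.univ T ε i) (y i) (x i) =
      if ∀ i ∈ T, y i = x i then (1 / 2) ^ (n - T.card) else 0 := by
    intro y
    rw [← Finset.prod_mul_prod_compl T]
    have e1 : ∏ i ∈ T, flipWeight (condVec Finset.univ T ε i) (y i) (x i) =
        if ∀ i ∈ T, y i = x i then 1 else 0 := by
      rw [Finset.prod_congr rfl (g := fun i => if y i = x i then (1 : ℝ) else 0), Finset.prod_boole]
      · congr
      · intro i hi
        simp [condVec, hi, flipWeight]
    have e2 : ∏ i ∈ Tᶜ, flipWeight (condVec Finset.univ T ε i) (y i) (x i) =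
        (1 / 2) ^ (n - T.card) := by
      rw [Finset.prod_congr rfl (g := fun _ => (1 / 2 : ℝ)), Finset.prod_const, Finset.card_compl,
        Fintype.card_fin]
      intro i hi
      have hi' := Finset.mem_compl.1 hi
      simp only [condVec, Finset.mem_univ, if_true, hi', if_false, flipWeight]
      norm_num
    rw [e1, e2, ite_mul, one_mul, zero_mul]
  have hc : (0 : ℝ) < Nat.card C := by exact_mod_cast Nat.card_pos
  have hsum : noiseVec (condVec Finset.univ T ε) (codeFun C) x =
      Nat.card {y : C // ∀ i ∈ T, (y : Cube n) i = x i} *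
        ((1 / 2) ^ (n - T.card) * (2 ^ n / (Nat.card C : ℝ))) := by
    have e : Nat.card {y : C // ∀ i ∈ T, (y : Cube n) i = x i} =
        (Finset.univ.filter fun y : Cube n => y ∈ C ∧ ∀ i ∈ T, y i = x i).card := by
      rw [← Fintype.card_subtype, ← Nat.card_eq_fintype_card]
      exact Nat.card_congr (Equiv.subtypeSubtypeEquivSubtypeInter (fun y : Cube n => y ∈ C)
        (fun y => ∀ i ∈ T, y i = x i))
    rw [e, ← nsmul_eq_mul, ← Finset.sum_const, Finset.sum_filter, noiseVec]
    refine Finset.sum_congr rfl fun y _ => ?_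
    rw [hw y, codeFun, Set.indicator_apply]
    by_cases h1 : y ∈ C <;> by_cases h2 : ∀ i ∈ T, y i = x i <;> simp [h1, h2]
  have hle : (Nat.card {y : C // ∀ i ∈ T, (y : Cube n) i = x i} : ℝ) * 2 ^ codeRank C T ≤
      Nat.card C := by exact_mod_cast card_filter_mul_two_pow_codeRank_le C T x
  have hT : T.card ≤ n := by simpa using T.card_le_univ
  have hpow : ((1 : ℝ) / 2) ^ (n - T.card) * 2 ^ n = 2 ^ T.card := by
    have e : (2 : ℝ) ^ n = 2 ^ (n - T.card) * 2 ^ T.card := by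
      rw [← pow_add, Nat.sub_add_cancel hT]
    rw [e, ← mul_assoc, ← mul_pow]
    norm_num
  rw [hsum, mul_div_assoc', hpow, le_div_iff₀ (by positivity), mul_div_assoc', div_mul_eq_mul_div,
    div_le_iff₀ hc]
  nlinarith [mul_le_mul_of_nonneg_left hle (show (0 : ℝ) ≤ 2 ^ T.card by positivity)]

theorem logb_two_pow_div (a b : ℕ) : Real.logb 2 ((2 : ℝ) ^ a / 2 ^ b) = (a : ℝ) - b := by
  rw [Real.logb_div (by positivity) (by positivity), Real.logb_pow, Real.logb_pow,
    Real.logb_self_eq_one (by norm_num), mul_one, mul_one]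

/-- Of the q factors in each summand, one is kept and sums to the total mass 2^n, which noise
preserves; the other q - 1 are bounded pointwise. -/
theorem logb_sum_noiseOp_codeFun_le {n q : ℕ} (hq : 2 ≤ q) {ε : ℝ} (h0 : 0 ≤ ε) (h1 : ε ≤ 1 / 2)
    (hl : 0 < noiseLambda q ε) (C : BinaryLinearCode n) :
    Real.logb 2 (∑ x, noiseOp ε (codeFun C) x ^ q) ≤
      n + ((q : ℝ) - 1) * subsetExp Finset.univ (noiseLambda q ε)
        (fun T => (T.card : ℝ) - (codeRank C T : ℝ)) := by
  refine (logb_sum_noiseOp_pow_le hq h0 h1 hl (codeFun_nonneg C) (codeFun_ne_zero C)).trans ?_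
  rw [← subsetExp_const Finset.univ (noiseLambda q ε) (n : ℝ), ← subsetExp_mul_left,
    ← subsetExp_add]
  apply subsetExp_mono hl.le (noiseLambda_le_one hq h0 h1)
  intro T _
  obtain ⟨m, rfl⟩ : ∃ m, q = m + 1 := ⟨q - 1, by omega⟩
  have he := condVec_mem_Icc Finset.univ T h0 h1
  have hle : ∑ x, noiseVec (condVec Finset.univ T ε) (codeFun C) x ^ (m + 1) ≤
      2 ^ n * (2 ^ T.card / 2 ^ codeRank C T) ^ m := by
    rw [← sum_codeFun C, ← sum_noiseVec (condVec Finset.univ T ε) (codeFun C), Finset.sum_mul]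
    refine Finset.sum_le_sum fun x _ => ?_
    have hx := noiseVec_nonneg he (codeFun_nonneg C) x
    rw [pow_succ']
    exact mul_le_mul_of_nonneg_left
      (pow_le_pow_left₀ hx (noiseVec_condVec_codeFun_le C T ε x) m) hx
  refine (Real.logb_le_logb_of_le (by norm_num)
    (sum_noiseVec_pow_pos he (codeFun_nonneg C) (codeFun_ne_zero C) _) hle).trans_eq ?_
  rw [Real.logb_mul (by positivity) (by positivity), Real.logb_pow, Real.logb_pow,
    logb_two_pow_div, Real.logb_self_eq_one (by norm_num)]
  push_cast
  ring

theorem logb_cubeSupNorm_noiseOp_codeFun_le {n : ℕ} {ε : ℝ} (h0 : 0 ≤ ε) (h1 : ε ≤ 1 / 2)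
    (C : BinaryLinearCode n) :
    Real.logb 2 (cubeSupNorm (noiseOp ε (codeFun C))) ≤
      subsetExp Finset.univ (noiseLambdaTop ε) (fun T => (T.card : ℝ) - (codeRank C T : ℝ)) := by
  refine (logb_cubeSupNorm_noiseOp_le h0 h1 (codeFun_nonneg C) (codeFun_ne_zero C)).trans ?_
  apply subsetExp_mono (noiseLambdaTop_nonneg h1) (noiseLambdaTop_le_one h0 h1)
  intro T _
  rw [← logb_two_pow_div]
  apply Real.logb_le_logb_of_le (by norm_num)
    (cubeSupNorm_noiseVec_pos _ (codeFun_nonneg C) (codeFun_ne_zero C))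
  refine ciSup_le fun x => ?_
  rw [abs_of_nonneg (noiseVec_nonneg (condVec_mem_Icc Finset.univ T h0 h1) (codeFun_nonneg C) x)]
  exact noiseVec_condVec_codeFun_le C T ε x

/-! ### Lower bounds for arbitrary nonnegative functions -/

theorem sum_rpow_le_rpow_sum {ι : Type*} (s : Finset ι) {f : ι → ℝ} (hf : ∀ i, 0 ≤ f i) {q : ℝ}
    (hq : 1 ≤ q) : ∑ i ∈ s, f i ^ q ≤ (∑ i ∈ s, f i) ^ q := by
  classical
  induction s using Finset.induction_on with
  | empty => simp [Real.zero_rpow (show q ≠ 0 by linarith)]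
  | insert i s hi ih =>
    rw [Finset.sum_insert hi, Finset.sum_insert hi]
    have h := Real.add_rpow_le_rpow_add (hf i) (Finset.sum_nonneg fun j (_ : j ∈ s) => hf j) hq
    linarith

/-- By superadditivity the q-th power may be taken inside the sum over y. For fixed y, the q-th
powers of the product weights then sum over x to (ε^q + (1-ε)^q)^n. -/
theorem mul_sum_rpow_le_sum_noiseOp_rpow {n : ℕ} {q ε : ℝ} (hq : 1 ≤ q) (h0 : 0 ≤ ε)
    (h1 : ε ≤ 1) {f : Cube n → ℝ} (hf : ∀ x, 0 ≤ f x) :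
    (ε ^ q + (1 - ε) ^ q) ^ n * ∑ x, f x ^ q ≤ ∑ x, noiseOp ε f x ^ q := by
  rw [noiseOp_eq_noiseVec]
  have hw : ∀ x y : Cube n, 0 ≤ ∏ i, flipWeight ε (y i) (x i) := fun x y =>
    Finset.prod_nonneg fun i _ => flipWeight_nonneg h0 h1 _ _
  calc (ε ^ q + (1 - ε) ^ q) ^ n * ∑ x, f x ^ q
      = ∑ y : Cube n, ∑ x : Cube n, ((∏ i, flipWeight ε (y i) (x i)) * f y) ^ q := by
        rw [Finset.mul_sum]
        refine Finset.sum_congr rfl fun y _ => ?_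
        have e : ∀ x : Cube n, ((∏ i, flipWeight ε (y i) (x i)) * f y) ^ q =
            (∏ i, flipWeight ε (y i) (x i) ^ q) * f y ^ q := fun x => by
          rw [Real.mul_rpow (hw x y) (hf y), Real.finsetProd_rpow]
          exact fun i _ => flipWeight_nonneg h0 h1 _ _
        simp only [e]
        rw [← Finset.sum_mul, sum_prod_flipWeight (fun i b => flipWeight ε (y i) b ^ q)]
        simp [sum_comp_flipWeight (fun t => t ^ q), add_comm]
    _ = ∑ x : Cube n, ∑ y : Cube n, ((∏ i, flipWeight ε (y i) (x i)) * f y) ^ q :=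
        Finset.sum_comm
    _ ≤ _ := Finset.sum_le_sum fun x _ =>
        sum_rpow_le_rpow_sum _ (fun y => mul_nonneg (hw x y) (hf y)) hq

/-- At a point where f is maximal, the term y = x alone contributes (1-ε)^n times the maximum. -/
theorem pow_mul_cubeSupNorm_le {n : ℕ} {ε : ℝ} (h0 : 0 ≤ ε) (h1 : ε ≤ 1) {f : Cube n → ℝ}
    (hf : ∀ x, 0 ≤ f x) : (1 - ε) ^ n * cubeSupNorm f ≤ cubeSupNorm (noiseOp ε f) := by
  obtain ⟨x, hx⟩ := exists_eq_ciSup_of_finite (f := fun x => |f x|)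
  have hx' : cubeSupNorm f = f x := by
    rw [← abs_of_nonneg (hf x)]
    exact hx.symm
  refine le_trans ?_ ((le_abs_self _).trans (le_cubeSupNorm (noiseOp ε f) x))
  have h := Finset.single_le_sum (f := fun y => (∏ i, flipWeight ε (y i) (x i)) * f y)
    (fun y _ => mul_nonneg (Finset.prod_nonneg fun i _ => flipWeight_nonneg h0 h1 _ _) (hf y))
    (Finset.mem_univ x)
  rw [hx', noiseOp_eq_noiseVec]
  refine le_trans (le_of_eq ?_) h
  simp [flipWeight]

/-! ### Passage to normalized norms and the proposition -/

theorem logb_cubeNorm {n : ℕ} {q : ℝ} {g : Cube n → ℝ} (hg : ∀ x, 0 ≤ g x)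
    (hpos : 0 < ∑ x, g x ^ q) :
    Real.logb 2 (cubeNorm q g) = 1 / q * (Real.logb 2 (∑ x, g x ^ q) - n) := by
  have e : ∑ x, |g x| ^ q = ∑ x, g x ^ q :=
    Finset.sum_congr rfl fun x _ => by rw [abs_of_nonneg (hg x)]
  rw [cubeNorm, e, Real.logb_rpow_eq_mul_logb_of_pos (by positivity),
    Real.logb_div hpos.ne' (by positivity), Real.logb_pow, Real.logb_self_eq_one (by norm_num),
    mul_one]

theorem noiseOp_nonneg {n : ℕ} {ε : ℝ} (h0 : 0 ≤ ε) (h1 : ε ≤ 1) {f : Cube n → ℝ}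
    (hf : ∀ x, 0 ≤ f x) (x : Cube n) : 0 ≤ noiseOp ε f x := by
  rw [noiseOp_eq_noiseVec]
  exact noiseVec_nonneg (fun _ => ⟨h0, h1⟩) hf x

theorem logb_cubeNorm_noiseOp_codeFun_le {n q : ℕ} (hq : 2 ≤ q) {ε R : ℝ} (h0 : 0 ≤ ε)
    (h1 : ε ≤ 1 / 2) (hR0 : 0 < R) (hR : R ≤ noiseLambda q ε) (C : BinaryLinearCode n) :
    Real.logb 2 (cubeNorm q (noiseOp ε (codeFun C))) ≤ ((q : ℝ) - 1) / q *
      (expectRandomSubset R (fun T => (T.card : ℝ) - (codeRank C T : ℝ)) +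
        (noiseLambda q ε - R) * n) := by
  have hq' : (2 : ℝ) ≤ q := by exact_mod_cast hq
  have hl := hR0.trans_le hR
  have hpos : 0 < ∑ x, noiseOp ε (codeFun C) x ^ (q : ℝ) := by
    rw [noiseOp_eq_noiseVec]
    exact sum_noiseVec_rpow_pos (fun _ => ⟨h0, by linarith⟩) (codeFun_nonneg C)
      (codeFun_ne_zero C) _
  rw [logb_cubeNorm (noiseOp_nonneg h0 (by linarith) (codeFun_nonneg C)) hpos]
  simp only [Real.rpow_natCast]
  have h := logb_sum_noiseOp_codeFun_le hq h0 h1 hl C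
  have hE := expect_card_sub_codeRank_le C hR0.le hR (noiseLambda_le_one hq h0 h1)
  rw [one_div_mul_eq_div, div_mul_eq_mul_div]
  apply div_le_div_of_nonneg_right _ (by linarith)
  have := mul_le_mul_of_nonneg_left hE (show (0 : ℝ) ≤ q - 1 by linarith)
  linarith

theorem proposition1p3 :
    -- first part: pseudorandom codes, with a lower order term that is uniform in `q` and `ε`
    (∀ (R : ℝ) (n : ℕ → ℕ) (C : ∀ k, BinaryLinearCode (n k)),
      0 < R → R < 1 → IsPseudorandomCode R n C →
      ∀ η : ℝ, 0 < η → ∀ᶠ k in atTop,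
        (∀ (q : ℕ) (ε : ℝ), 2 ≤ q → 0 ≤ ε → ε ≤ 1 / 2 → R ≤ noiseLambda q ε →
          1 / (n k : ℝ) * Real.logb 2 (cubeNorm q (noiseOp ε (codeFun (C k)))) ≤
            ((q : ℝ) - 1) / q * (noiseLambda q ε - R) + η) ∧
        (∀ ε : ℝ, 0 ≤ ε → ε ≤ 1 / 2 → R ≤ noiseLambdaTop ε →
          1 / (n k : ℝ) * Real.logb 2 (cubeSupNorm (noiseOp ε (codeFun (C k)))) ≤
            (noiseLambdaTop ε - R) + η)) ∧
    -- second part: the converse bound for arbitrary nonnegative functions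
    (∀ (n : ℕ) (f : Cube n → ℝ) (R : ℝ), 0 < n → (∀ x, 0 ≤ f x) → f ≠ 0 →
      (∀ q : ℝ, 1 ≤ q → 1 / (n : ℝ) * Real.logb 2 (cubeNorm q f) = (q - 1) / q * (1 - R) →
        ∀ ε : ℝ, 0 ≤ ε → ε ≤ 1 / 2 →
          1 / (n : ℝ) * Real.logb 2 (cubeNorm q (noiseOp ε f)) ≥
            (q - 1) / q * (noiseLambda q ε - R)) ∧
      (1 / (n : ℝ) * Real.logb 2 (cubeSupNorm f) = 1 - R →
        ∀ ε : ℝ, 0 ≤ ε → ε ≤ 1 / 2 →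
          1 / (n : ℝ) * Real.logb 2 (cubeSupNorm (noiseOp ε f)) ≥ noiseLambdaTop ε - R)) := by
  refine ⟨?_, ?_⟩
  · intro R n C hR0 hR1 hC η hη
    -- The error is bounded by ηn through the expectation at probability R, in which neither q nor ε
    -- occurs; this, with (q-1)/q ≤ 1, gives the uniformity.
    filter_upwards [hC.achieves_capacity.bound hη, hC.length_tendsto.eventually_gt_atTop 0]
      with k hk hn
    have hn' : (0 : ℝ) < n k := by exact_mod_cast hn
    rw [Real.norm_of_nonneg hn'.le] at hk
    have hE := (le_abs_self _).trans hk
    refine ⟨fun q ε hq h0 h1 hR => ?_, fun ε h0 h1 hR => ?_⟩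
    · have hq' : (2 : ℝ) ≤ q := by exact_mod_cast hq
      have h := logb_cubeNorm_noiseOp_codeFun_le hq h0 h1 hR0 hR (C k)
      have hc0 : 0 ≤ ((q : ℝ) - 1) / q := div_nonneg (by linarith) (by linarith)
      have hc1 : ((q : ℝ) - 1) / q ≤ 1 := by
        rw [div_le_one (by linarith)]
        linarith
      rw [one_div_mul_eq_div, div_le_iff₀ hn']
      have e1 := mul_le_mul_of_nonneg_left hE hc0
      have e2 := mul_le_mul_of_nonneg_right hc1 (mul_pos hη hn').le
      linarith
    · have h := logb_cubeSupNorm_noiseOp_codeFun_le h0 h1 (C k)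
      have h' := expect_card_sub_codeRank_le (C k) hR0.le hR (noiseLambdaTop_le_one h0 h1)
      rw [one_div_mul_eq_div, div_le_iff₀ hn']
      linarith
  · intro n f R hn hf hf0
    have hn' : (0 : ℝ) < n := by exact_mod_cast hn
    refine ⟨fun q hq hR ε h0 h1 => ?_, fun hR ε h0 h1 => ?_⟩
    · have hq0 : 0 < q := by linarith
      obtain ⟨z, hz⟩ := Function.ne_iff.1 hf0
      have hF : 0 < ∑ x, f x ^ q :=
        Finset.sum_pos' (fun x _ => Real.rpow_nonneg (hf x) q) ⟨z, Finset.mem_univ z,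
          Real.rpow_pos_of_pos (lt_of_le_of_ne (hf z) (Ne.symm hz)) q⟩
      have hb : 0 < ε ^ q + (1 - ε) ^ q :=
        add_pos_of_nonneg_of_pos (Real.rpow_nonneg h0 q) (Real.rpow_pos_of_pos (by linarith) q)
      have hle := mul_sum_rpow_le_sum_noiseOp_rpow hq h0 (by linarith) hf
      have hTF : 0 < ∑ x, noiseOp ε f x ^ q := lt_of_lt_of_le (by positivity) hle
      have hlog := Real.logb_le_logb_of_le (b := 2) (by norm_num) (by positivity) hle
      rw [Real.logb_mul (by positivity) hF.ne', Real.logb_pow] at hlog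
      rw [logb_cubeNorm hf hF] at hR
      rw [logb_cubeNorm (noiseOp_nonneg h0 (by linarith) hf) hTF]
      have hlam : (q - 1) / q * (noiseLambda q ε - R) =
          (q - 1) / q * (1 - R) + 1 / q * Real.logb 2 (ε ^ q + (1 - ε) ^ q) := by
        rw [noiseLambda]
        -- At q = 1 the factor (q-1)/q is 0 and log₂(ε + (1-ε)) = 0, so both sides vanish whatever
        -- value the division by q - 1 takes.
        rcases hq.eq_or_lt with rfl | hq1
        · simp
        · have : q - 1 ≠ 0 := by linarith
          field_simp
          ring
      rw [hlam, ← hR, ge_iff_le]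
      have h2 : 1 / (n : ℝ) * (1 / q * (n * Real.logb 2 (ε ^ q + (1 - ε) ^ q) +
          Real.logb 2 (∑ x, f x ^ q) - n)) ≤
          1 / (n : ℝ) * (1 / q * (Real.logb 2 (∑ x, noiseOp ε f x ^ q) - n)) :=
        mul_le_mul_of_nonneg_left (mul_le_mul_of_nonneg_left (by linarith) (by positivity))
          (by positivity)
      refine le_trans (le_of_eq ?_) h2
      field_simp
      ring
    · have hpos : 0 < cubeSupNorm f := by
        obtain ⟨z, hz⟩ := Function.ne_iff.1 hf0
        exact (abs_pos.2 hz).trans_le (le_cubeSupNorm f z)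
      have he : 0 < 1 - ε := by linarith
      have hlog := Real.logb_le_logb_of_le (b := 2) (by norm_num) (by positivity)
        (pow_mul_cubeSupNorm_le h0 (by linarith) hf)
      rw [Real.logb_mul (by positivity) hpos.ne', Real.logb_pow] at hlog
      rw [one_div_mul_eq_div, div_eq_iff hn'.ne'] at hR
      rw [ge_iff_le, one_div_mul_eq_div, le_div_iff₀ hn', noiseLambdaTop]
      linarith
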